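/- All alphabets are finite. A variety of languages $\mathcal V$ assigns to each alphabet $A$ a Boolean algebra $\mathcal V_A$ of subsets of $A^*$ such that (i) $L\in\mathcal V_B$ implies $\varphi^{-1}(L)\in\mathcal V_A$ for every monoid morphism $\varphi:A^*\to B^*$, and (ii) $L\in\mathcal V_A$ and $a\in A$ imply $a^{-1}L=\{w: aw\in L\}\in\mathcal V_A$ and $La^{-1}=\{w: wa\in L\}\in\mathcal V_A$. A language is commutative if membership of a word is invariant under permuting its letters. For a finite partition $\mathcal D$ of $\mathbb N^2$ let $\tau_{\mathcal D}:A^*\to(A\times\mathcal D)^*$ be the length-preserving map that sends the $i$-th letter $w_i$ of $w$ ($0\le i<|w|$) to $(w_i,[(i,|w|-1-i)]_{\mathcal D})$, where $[\cdot]_{\mathcal D}$ denotes the class in $\mathcal D$. Let $(\mathcal V\,\square\,\mathcal P_{\mathrm{arb}})_A$ be the Boolean algebra of subsets of $A^*$ generated by the languages $\tau_{\mathcal D}^{-1}(K)$, for all finite partitions $\mathcal D$ of $\mathbb N^2$ and all $K\in\mathcal V_{A\times\mathcal D}$. For a set $X$ let $\beta X$ be the set of ultrafilters on $X$; for $g:X\to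 Y$ and $\gamma\in\beta X$ let $\beta g(\gamma)=\{L\subseteq Y: g^{-1}(L)\in\gamma\}\in\beta Y$. A profinite word over $A$ is an ultrafilter of the Boolean algebra of regular languages over $A$. For profinite words $u,v$ over $A$, $[u=v]$ is a profinite identity of $\mathcal V$ if for all $L\in\mathcal V_A$ and $x,y\in A^*$ one has $x^{-1}Ly^{-1}\in u\Leftrightarrow x^{-1}Ly^{-1}\in v$, where $x^{-1}Ly^{-1}=\{w : xwy\in L\}$. Let $X=A^*\times A^*\times(\mathbb N^2)^*$, and write $q=(q^1,q^2)$ for $q\in\mathbb N^2$. Let $\mathfrak D\subseteq X$ be the set of triples $(w,s,p)$ with $|s|=|p|$, $p_i^1+p_i^2=|w|-1$ for all $i$, and $p^1_0<\dots<p^1_{|p|-1}<|w|$. Let $f:X\to A^*$ send $(w,s,p)\in\mathfrak D$ to the word obtained from $w$ by replacing, for each $i$, the letter at position $p_i^1$ by $s_i$, and send $(w,s,p)\notin\mathfrak D$ to $w$. Let $\lambda:X\to A^*\times\mathbb N\times(\mathbb N^2)^*$, $\lambda(w,s,p)=(w,|s|,p)$, and $\pi_2(w,s,p)=s$. Let $\pi_c(w,s,p)$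 be the filter of all $P\subseteq\mathbb N^2$ that contain the content $\{p_0,\dots,p_{|p|-1}\}$ of $p$, and let $\beta\pi_c$ be its continuous extension to $\beta X$, with values in the filters on $\mathbb N^2$: $P\in\beta\pi_c(\gamma)\Leftrightarrow\{t\in X: P\in\pi_c(t)\}\in\gamma$. **Theorem.** Let $\mathcal V$ be a variety of languages all of whose languages are regular and commutative, and which is non-trivial, i.e. some $\mathcal V_B$ contains a language other than $\emptyset$ and $B^*$. Let $A$ be a finite alphabet. Then the Boolean algebra $(\mathcal V\,\square\,\mathcal P_{\mathrm{arb}})_A$ is defined by the ultrafilter equations $[\beta f(\gamma_u)\leftrightarrow\beta f(\gamma_v)]$, where $[u=v]$ ranges over the profinite identities of $\mathcal V$ with $u,v$ profinite words over $A$, and $\gamma_u,\gamma_v$ range over the ultrafilters on $X$ with 1. $\beta\lambda(\gamma_u)=\beta\lambda(\gamma_v)$, 2. $u\subseteq\beta\pi_2(\gamma_u)$ and $v\subseteq\beta\pi_2(\gamma_v)$, 3. $\beta\pi_c(\gamma_u)=\beta\pi_c(\gamma_v)$, and this filter is an ultrafilter, i.e. an element of $\beta(\mathbb N^2)$. That is,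 a language $L\subseteq A^*$ belongs to $(\mathcal V\,\square\,\mathcal P_{\mathrm{arb}})_A$ if and only if $L\in\beta f(\gamma_u)\Leftrightarrow L\in\beta f(\gamma_v)$ for all such $u,v,\gamma_u,\gamma_v$. -/

import Mathlib

universe u

namespace BlockProduct

open Filter

/-- A variety of languages: to each finite alphabet `A` a Boolean algebra of languages over `A`,
closed under inverse images of monoid morphisms between free monoids and under left and right
quotients by letters. -/
structure LanguageVariety where
  lang : ∀ (A : Type u) [Finite A], BooleanSubalgebra (Set (List A))
  preimage_mem : ∀ {A B : Type u} [Finite A] [Finite B] (φ : FreeMonoid A →* FreeMonoid B)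
    (L : Set (List B)), L ∈ lang B →
      {w : List A | FreeMonoid.toList (φ (FreeMonoid.ofList w)) ∈ L} ∈ lang A
  leftQuotient_mem : ∀ {A : Type u} [Finite A] (a : A) (L : Set (List A)), L ∈ lang A →
    {w : List A | a :: w ∈ L} ∈ lang A
  rightQuotient_mem : ∀ {A : Type u} [Finite A] (a : A) (L : Set (List A)), L ∈ lang A →
    {w : List A | w ++ [a] ∈ L} ∈ lang A

/-- The Boolean algebra of regular languages over `A`. -/
def regularLanguages (A : Type u) : BooleanSubalgebra (Set (List A)) where
  carrier := {L | Language.IsRegular (T := A) L}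
  supClosed' := fun _ h₁ _ h₂ => Language.IsRegular.add h₁ h₂
  infClosed' := fun _ h₁ _ h₂ => Language.IsRegular.inf h₁ h₂
  compl_mem' := fun h => Language.IsRegular.compl h
  bot_mem' := ⟨Unit, inferInstance, ⟨fun _ _ => (), (), ∅⟩, rfl⟩

/-- A language is commutative if membership is invariant under permuting the letters of a word. -/
def IsCommutativeLanguage {A : Type u} (L : Set (List A)) : Prop :=
  ∀ w w' : List A, w.Perm w' → (w ∈ L ↔ w' ∈ L)

namespace LanguageVariety

/-- Every language of the variety is regular. -/
def IsRegular (V : LanguageVariety.{u}) : Prop :=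
  ∀ (A : Type u) [Finite A], V.lang A ≤ regularLanguages A

/-- Every language of the variety is commutative. -/
def IsCommutative (V : LanguageVariety.{u}) : Prop :=
  ∀ (A : Type u) [Finite A], ∀ L ∈ V.lang A, IsCommutativeLanguage L

/-- Some language of the variety is neither empty nor full. -/
def IsNontrivial (V : LanguageVariety.{u}) : Prop :=
  ∃ (A : Type u) (_ : Finite A), ∃ L ∈ V.lang A, L ≠ ∅ ∧ L ≠ Set.univ

end LanguageVariety

/-- The transduction `τ_D` for a partition `D` of `ℕ²`, given as a setoid whose quotient is the
set of classes: the letter `w_i` becomes `(w_i, [(i, |w| - 1 - i)]_D)`. -/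
def transduction {A : Type u} (D : Setoid (ℕ × ℕ)) (w : List A) : List (A × Quotient D) :=
  w.mapIdx fun i a => (a, (Quotient.mk D (i, w.length - 1 - i)))

/-- `(V □ P_arb)_A`: the Boolean algebra generated by the languages `τ_D⁻¹(K)`, with `D` a
finite partition of `ℕ²` and `K` in `V_{A × D}`. -/
def blockProduct (V : LanguageVariety.{u}) (A : Type u) [Finite A] :
    BooleanSubalgebra (Set (List A)) :=
  BooleanSubalgebra.closure
    {L | ∃ (D : Setoid (ℕ × ℕ)) (_ : Finite (Quotient D)),
      ∃ K ∈ V.lang (A × Quotient D), L = transduction D ⁻¹' K}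

/-- A point of the Stone space of a Boolean algebra `𝓑` of subsets of `X`: an ultrafilter
of `𝓑`. -/
structure StonePoint {X : Type u} (𝓑 : BooleanSubalgebra (Set X)) where
  sets : Set (Set X)
  sets_subset : ∀ L ∈ sets, L ∈ 𝓑
  nonempty : sets.Nonempty
  empty_notMem : ∅ ∉ sets
  mem_of_superset : ∀ L ∈ sets, ∀ K ∈ 𝓑, L ⊆ K → K ∈ sets
  inter_mem : ∀ L ∈ sets, ∀ K ∈ sets, L ∩ K ∈ sets
  mem_or_compl_mem : ∀ L ∈ 𝓑, L ∈ sets ∨ Lᶜ ∈ sets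

/-- Profinite words over `A`: ultrafilters of the Boolean algebra of regular languages. -/
abbrev ProfiniteWord (A : Type u) := StonePoint (regularLanguages A)

/-- The Boolean algebra `𝓑` satisfies the profinite identity `[u = v]`: all two-sided quotients
`x⁻¹ L y⁻¹` of languages `L` of `𝓑` belong to `u` iff they belong to `v`. -/
def SatisfiesIdentity {A : Type u} (𝓑 : BooleanSubalgebra (Set (List A)))
    (p q : ProfiniteWord A) : Prop :=
  ∀ L ∈ 𝓑, ∀ x y : List A,
    ({w : List A | x ++ w ++ y ∈ L} ∈ p.sets ↔ {w : List A | x ++ w ++ y ∈ L} ∈ q.sets)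

/-- A Boolean algebra of subsets of `X` is defined by a set of ultrafilter equations
`[μ ↔ ν]` if its members are exactly the sets `L` with `L ∈ μ ↔ L ∈ ν` for all of them. -/
def IsDefinedBy {X : Type u} (𝓑 : BooleanSubalgebra (Set X))
    (E : Set (Ultrafilter X × Ultrafilter X)) : Prop :=
  ∀ L : Set X, L ∈ 𝓑 ↔ ∀ e ∈ E, (L ∈ e.1 ↔ L ∈ e.2)

/-- `A* × A* × (ℕ²)*`. -/
abbrev Triple (A : Type u) := List A × List A × List (ℕ × ℕ)

/-- The set of correct substitutions `(w, s, p)`. -/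
def correctSubstitutions (A : Type u) : Set (Triple A) :=
  {t | t.2.1.length = t.2.2.length ∧
    (∀ q ∈ t.2.2, q.1 + q.2 + 1 = t.1.length) ∧
    (∀ q ∈ t.2.2, q.1 < t.1.length) ∧
    t.2.2.Pairwise (fun q q' => q.1 < q'.1)}

open Classical in
/-- The substitution map `f`: for a correct substitution `(w, s, p)`, the letter of `w` at
position `p_i^1` is replaced by `s_i` for every `i`; otherwise the value is `w`. -/
noncomputable def substitute {A : Type u} (t : Triple A) : List A :=
  if t ∈ correctSubstitutions A then
    (t.2.2.zip t.2.1).foldl (fun w qa => w.set qa.1.1 qa.2) t.1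
  else t.1

/-- `λ (w, s, p) = (w, |s|, p)`. -/
def lengthMap {A : Type u} (t : Triple A) : List A × ℕ × List (ℕ × ℕ) :=
  (t.1, t.2.1.length, t.2.2)

/-- `π₂ (w, s, p) = s`. -/
def secondComponent {A : Type u} (t : Triple A) : List A := t.2.1

/-- `π_c`: the content `{p_0, p_1, …}` of the third component, as a filter on `ℕ²` (the
principal filter of the content, which is the intersection of all ultrafilters containing it). -/
def content {A : Type u} (t : Triple A) : Filter (ℕ × ℕ) := 𝓟 {q | q ∈ t.2.2}

/-- `βπ_c`, the continuous extension of `π_c` to ultrafilters: `P` belongs to `βπ_c(γ)` iff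
`{t | P ∈ π_c(t)} ∈ γ`. See `betaContent_unique`. -/
def betaContent {A : Type u} (γ : Ultrafilter (Triple A)) : Filter (ℕ × ℕ) :=
  Filter.bind (γ : Filter (Triple A)) content

theorem mem_betaContent {A : Type u} (γ : Ultrafilter (Triple A)) (P : Set (ℕ × ℕ)) :
    P ∈ betaContent γ ↔ {t : Triple A | ∀ q ∈ t.2.2, q ∈ P} ∈ γ :=
  Iff.rfl

/-- `betaContent` is the unique extension of `content` that is continuous for the topology on
filters that has the sets `{F | P ∈ F}` and their complements as a subbasis (the Vietoris
topology on the closed subsets of `β(ℕ²)`). -/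
theorem betaContent_unique {A : Type u} (F : Ultrafilter (Triple A) → Filter (ℕ × ℕ)) :
    F = betaContent ↔
      (∀ t, F (pure t) = content t) ∧ ∀ P, IsClopen {γ | P ∈ F γ} := by
  have clop : ∀ P : Set (ℕ × ℕ), IsClopen {γ : Ultrafilter (Triple A) | P ∈ betaContent γ} :=
    fun P => ⟨ultrafilter_isClosed_basic {t : Triple A | ∀ q ∈ t.2.2, q ∈ P},
      ultrafilter_isOpen_basic {t : Triple A | ∀ q ∈ t.2.2, q ∈ P}⟩
  have hpure : ∀ t : Triple A, betaContent (pure t) = content t := fun t => by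
    ext P
    exact Iff.rfl
  constructor
  · rintro rfl
    exact ⟨hpure, clop⟩
  · rintro ⟨h₁, h₂⟩
    funext γ
    ext P
    have key : (fun γ => (P ∈ F γ : Prop)) = fun γ => (P ∈ betaContent γ : Prop) := by
      have e : {γ | P ∈ F γ} = {γ | P ∈ betaContent γ} := by
        have c₁ := (IsClopen.compl (h₂ P)).inter (clop P)
        have c₂ := (IsClopen.compl (clop P)).inter (h₂ P)
        have aux : ∀ U : Set (Ultrafilter (Triple A)), IsOpen U →
            (∀ t, (pure t : Ultrafilter (Triple A)) ∉ U) → U = ∅ := by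
          intro U hU hn
          by_contra hne
          obtain ⟨x, hx, t, rfl⟩ :=
            denseRange_pure.inter_open_nonempty U hU (Set.nonempty_iff_ne_empty.2 hne)
          exact hn t hx
        have e₁ := aux _ c₁.2 fun t ht => ht.1 (by
          have := ht.2
          simp only [Set.mem_ofPred_eq, h₁, hpure] at this ⊢
          exact this)
        have e₂ := aux _ c₂.2 fun t ht => ht.1 (by
          have := ht.2
          simp only [Set.mem_ofPred_eq, h₁, hpure] at this ⊢
          exact this)
        ext x
        constructor
        · intro hx
          by_contra hn
          exact (Set.ext_iff.1 e₂ x).1 ⟨hn, hx⟩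
        · intro hx
          by_contra hn
          exact (Set.ext_iff.1 e₁ x).1 ⟨hn, hx⟩
      exact e
    exact iff_of_eq (congrFun key γ)

/-- The conditions on a pair of ultrafilters `γu`, `γv` associated with profinite words
`p`, `q`. -/
structure Compatible {A : Type u} (p q : ProfiniteWord A)
    (γu γv : Ultrafilter (Triple A)) : Prop where
  length_eq : γu.map lengthMap = γv.map lengthMap
  left_subset : ∀ L ∈ p.sets, L ∈ γu.map secondComponent
  right_subset : ∀ L ∈ q.sets, L ∈ γv.map secondComponent
  content_eq : betaContent γu = betaContent γv
  content_ultra : ∃ α : Ultrafilter (ℕ × ℕ), betaContent γu = (α : Filter (ℕ × ℕ))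

/-- The set of all equations `[βf(γu) ↔ βf(γv)]` over all profinite identities `[p = q]`
of `V`. -/
def blockEquations (V : LanguageVariety.{u}) (A : Type u) [Finite A] :
    Set (Ultrafilter (List A) × Ultrafilter (List A)) :=
  {e | ∃ p q : ProfiniteWord A, SatisfiesIdentity (V.lang A) p q ∧
    ∃ γu γv : Ultrafilter (Triple A), Compatible p q γu γv ∧
      e = (γu.map substitute, γv.map substitute)}

end BlockProduct

/-! Membership in a commutative regular language depends only on its letter counts, each taken up to
a threshold `t` and a period `m`. Restricting to powers of one letter shows that a variety
containing the language can itself perform this counting (`exists_counts_saturated`). So the block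
product consists of the languages determined by finitely many counts of letters on sets of
positions, together with the length, which a nontrivial variety recovers by telling the counts 0 and
1 apart.

Soundness: let a generator be given by `D` and `K`. Since the content is an ultrafilter, almost all
substitutions take place inside one class `c` of `D`. Up to permutation, the transduced word is then
a part depending only on `lengthMap` followed by `s` labelled with `c`. As `K` has finitely many
quotients, that part may be replaced by a fixed word, and membership becomes a condition on `s`
given by a language of the variety, about which `u` and `v` agree.

Completeness: the sets of positions on which counts determine `L` form an ideal. If the ideal
contains all of `ℕ²`, then `L` is in the block product. Otherwise some ultrafilter `α` on `ℕ²`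
avoids it. For each `P ∈ α` and each available counting there is then a pair of words, one in `L`
and one not, that differ only in `P` and whose replaced and replacing letters have equivalent
counts. The exchange argument `imp_of_card_thresholdEq` is needed here: equivalent counts on all of
`P` do not give equivalent counts on the differing positions. An ultrafilter on such pairs yields a
violated equation. -/

namespace BlockProduct

/-! ### Saturated sets, and congruences of the additive monoid `ℕ` -/

/-- A set that is saturated for the equivalence given by finitely many members of a Boolean
algebra of sets belongs to the algebra. -/
theorem mem_of_saturated {X : Type*} (𝓑 : BooleanSubalgebra (Set X)) {F : Set (Set X)}
    (hF : F.Finite) (hF𝓑 : ∀ S ∈ F, S ∈ 𝓑) (C : Set X)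
    (hC : ∀ x y, (∀ S ∈ F, (x ∈ S ↔ y ∈ S)) → x ∈ C → y ∈ C) : C ∈ 𝓑 := by
  induction F, hF using Set.Finite.induction_on generalizing C with
  | empty =>
    rcases C.eq_empty_or_nonempty with rfl | ⟨x, hx⟩
    · exact BooleanSubalgebra.bot_mem
    · have : C = ⊤ := Set.eq_univ_of_forall fun y => hC x y (by simp) hx
      rw [this]
      exact BooleanSubalgebra.top_mem
  | @insert S F _ _ ih =>
    have hF' : ∀ T ∈ F, T ∈ 𝓑 := fun T hT => hF𝓑 T (Set.mem_insert_of_mem _ hT)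
    have hS : S ∈ 𝓑 := hF𝓑 S (Set.mem_insert _ _)
    -- The saturation of any set under `F` alone lies in the algebra; `C` is glued from two of
    -- these, one on each side of `S`.
    have sat : ∀ E : Set X, {y | ∃ x ∈ E, ∀ T ∈ F, (x ∈ T ↔ y ∈ T)} ∈ 𝓑 := fun E =>
      ih hF' _ fun y z hyz ⟨x, hx, hxy⟩ => ⟨x, hx, fun T hT => (hxy T hT).trans (hyz T hT)⟩
    have e : C = (S ∩ {y | ∃ x ∈ S ∩ C, ∀ T ∈ F, (x ∈ T ↔ y ∈ T)}) ∪
        (Sᶜ ∩ {y | ∃ x ∈ Sᶜ ∩ C, ∀ T ∈ F, (x ∈ T ↔ y ∈ T)}) := by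
      ext y
      constructor
      · intro hy
        by_cases h : y ∈ S
        · exact Or.inl ⟨h, y, ⟨h, hy⟩, fun _ _ => Iff.rfl⟩
        · exact Or.inr ⟨h, y, ⟨h, hy⟩, fun _ _ => Iff.rfl⟩
      · rintro (⟨h, x, ⟨hxS, hxC⟩, hx⟩ | ⟨h, x, ⟨hxS, hxC⟩, hx⟩)
        · refine hC x y ?_ hxC
          rintro T (rfl | hT)
          · exact iff_of_true hxS h
          · exact hx T hT
        · refine hC x y ?_ hxC
          rintro T (rfl | hT)
          · exact iff_of_false hxS h
          · exact hx T hT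
    rw [e]
    exact BooleanSubalgebra.sup_mem (BooleanSubalgebra.inf_mem hS (sat _))
      (BooleanSubalgebra.inf_mem (BooleanSubalgebra.compl_mem hS) (sat _))

/-- Equality of natural numbers up to threshold `t` and period `m`. -/
def ThresholdEq (t m i j : ℕ) : Prop :=
  i = j ∨ (t ≤ i ∧ t ≤ j ∧ i ≡ j [MOD m])

namespace ThresholdEq

variable {t m t' m' i j k l : ℕ}

theorem refl (t m i : ℕ) : ThresholdEq t m i i := Or.inl rfl

theorem symm (h : ThresholdEq t m i j) : ThresholdEq t m j i := by
  rcases h with rfl | ⟨h₁, h₂, h₃⟩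
  · exact refl _ _ _
  · exact Or.inr ⟨h₂, h₁, h₃.symm⟩

theorem trans (h : ThresholdEq t m i j) (h' : ThresholdEq t m j k) : ThresholdEq t m i k := by
  rcases h with rfl | ⟨h₁, h₂, h₃⟩
  · exact h'
  · rcases h' with rfl | ⟨h₄, h₅, h₆⟩
    · exact Or.inr ⟨h₁, h₂, h₃⟩
    · exact Or.inr ⟨h₁, h₅, h₃.trans h₆⟩

theorem add_right (h : ThresholdEq t m i j) (k : ℕ) : ThresholdEq t m (i + k) (j + k) := by
  rcases h with rfl | ⟨h₁, h₂, h₃⟩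
  · exact refl _ _ _
  · exact Or.inr ⟨by omega, by omega, h₃.add_right k⟩

theorem mono (ht : t ≤ t') (hm : m ∣ m') (h : ThresholdEq t' m' i j) : ThresholdEq t m i j := by
  rcases h with rfl | ⟨h₁, h₂, h₃⟩
  · exact refl _ _ _
  · exact Or.inr ⟨ht.trans h₁, ht.trans h₂, h₃.of_dvd hm⟩

/-- Congruence modulo both periods is congruence modulo their lcm. Hence finitely many countings
always have a common refinement. -/
theorem max_lcm_iff : ThresholdEq (max t t') (m.lcm m') i j ↔
    ThresholdEq t m i j ∧ ThresholdEq t' m' i j := by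
  constructor
  · exact fun h => ⟨h.mono (le_max_left _ _) (Nat.dvd_lcm_left _ _),
      h.mono (le_max_right _ _) (Nat.dvd_lcm_right _ _)⟩
  · rintro ⟨h | ⟨h₁, h₂, h₃⟩, h' | ⟨h₄, h₅, h₆⟩⟩
    · exact Or.inl h
    · exact Or.inl h
    · exact Or.inl h'
    · refine Or.inr ⟨max_le h₁ h₄, max_le h₂ h₅, ?_⟩
      rw [Nat.modEq_iff_dvd] at *
      have := lcm_dvd h₃ h₆
      rw [← Int.coe_lcm] at this
      simpa using this

/-- Every number is equivalent to one below `t + m`. -/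
theorem exists_lt (hm : 0 < m) (i : ℕ) : ∃ j < t + m, ThresholdEq t m j i := by
  rcases lt_or_ge i t with h | h
  · exact ⟨i, by omega, refl _ _ _⟩
  · refine ⟨t + (i - t) % m, by have := Nat.mod_lt (i - t) hm; omega, Or.inr ⟨by omega, h, ?_⟩⟩
    have : i = t + (i - t) := by omega
    conv_rhs => rw [this]
    exact (Nat.mod_modEq _ _).add_left t

end ThresholdEq

/-- A congruence of `ℕ` that identifies two distinct numbers is given by a threshold and a
period. -/
theorem exists_thresholdEq (r : ℕ → ℕ → Prop) (hr : Equivalence r)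
    (hadd : ∀ i j k, r i j → r (i + k) (j + k)) (hne : ∃ i j, i < j ∧ r i j) :
    ∃ t m, 0 < m ∧ ∀ i j, r i j ↔ ThresholdEq t m i j := by
  classical
  have h₁ : ∃ t, ∃ m, 0 < m ∧ r t (t + m) := by
    obtain ⟨i, j, hij, h⟩ := hne
    exact ⟨i, j - i, by omega, by rwa [Nat.add_sub_cancel' hij.le]⟩
  -- The threshold is the least number related to a larger one, and the period is the least gap
  -- there.
  obtain ⟨t, ht, htmin⟩ : ∃ t, (∃ m, 0 < m ∧ r t (t + m)) ∧
      ∀ s, (∃ m, 0 < m ∧ r s (s + m)) → t ≤ s :=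
    ⟨Nat.find h₁, Nat.find_spec h₁, fun s hs => Nat.find_min' h₁ hs⟩
  obtain ⟨m, ⟨hm, hrm⟩, hmmin⟩ : ∃ m, (0 < m ∧ r t (t + m)) ∧
      ∀ k, (0 < k ∧ r t (t + k)) → m ≤ k :=
    ⟨Nat.find ht, Nat.find_spec ht, fun s hs => Nat.find_min' ht hs⟩
  have hmul : ∀ q i, t ≤ i → r i (i + m * q) := by
    intro q
    induction q with
    | zero => exact fun i _ => by simpa using hr.refl i
    | succ q ih =>
      intro i hi
      refine hr.trans (ih i hi) ?_
      have := hadd _ _ (i - t + m * q) hrm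
      convert this using 1
      · omega
      · rw [Nat.mul_succ]; omega
  have hdvd : ∀ i k, r i (i + k) → m ∣ k := by
    intro i k h
    rcases Nat.eq_zero_or_pos k with rfl | hk
    · exact dvd_zero m
    have hti : t ≤ i := htmin i ⟨k, hk, h⟩
    -- Shifting the relation up to `t + m * i` puts it at a multiple of `m` above `t`, from where
    -- `hmul` folds it back to `t`; minimality of `m` then applies.
    have hq : i ≤ t + m * i := by nlinarith
    have e₁ := hadd _ _ (t + m * i - i) h
    have e₂ : r (t + m * i) (t + k + m * i) := by
      convert e₁ using 1 <;> omega
    have e₃ : r t (t + k) :=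
      hr.trans (hmul i t le_rfl) (hr.trans e₂ (hr.symm (hmul i (t + k) (by omega))))
    have e₄ : r t (t + k % m) := by
      refine hr.trans e₃ (hr.symm ?_)
      have := hmul (k / m) (t + k % m) (by omega)
      rwa [add_assoc, Nat.mod_add_div] at this
    by_contra hn
    have hpos : 0 < k % m := Nat.pos_of_ne_zero fun h0 => hn (Nat.dvd_of_mod_eq_zero h0)
    exact absurd (hmmin _ ⟨hpos, e₄⟩) (not_le.2 (Nat.mod_lt _ hm))
  have key : ∀ i k, r i (i + k) ↔ ThresholdEq t m i (i + k) := by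
    intro i k
    constructor
    · intro h
      rcases Nat.eq_zero_or_pos k with rfl | hk
      · exact Or.inl rfl
      · have hti : t ≤ i := htmin i ⟨k, hk, h⟩
        exact Or.inr ⟨hti, by omega, by
          simpa [Nat.ModEq] using (Nat.modEq_iff_dvd' (by omega : i ≤ i + k)).2
            (by simpa using hdvd i k h)⟩
    · rintro (h | ⟨h₁, _, h₃⟩)
      · rw [← h]; exact hr.refl i
      · obtain ⟨q, hq⟩ := (Nat.modEq_iff_dvd' (by omega : i ≤ i + k)).1 h₃
        have : k = m * q := by omega
        rw [this]
        exact hmul q i h₁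
  refine ⟨t, m, hm, fun i j => ?_⟩
  rcases le_total i j with h | h
  · have := key i (j - i)
    rwa [Nat.add_sub_cancel' h] at this
  · have := key j (i - j)
    rw [Nat.add_sub_cancel' h] at this
    exact ⟨fun h' => (this.1 (hr.symm h')).symm, fun h' => hr.symm (this.2 h'.symm)⟩

/-! ### Counting inside a commutative regular variety -/

namespace LanguageVariety

variable (V : LanguageVariety.{u})

/-- The variety can count the letters of a word up to threshold `t` and period `m`. -/
def Counts (t m : ℕ) : Prop :=
  0 < m ∧ ∀ i, {w : List PUnit.{u + 1} | ThresholdEq t m w.length i} ∈ V.lang PUnit.{u + 1}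

variable {V}

theorem counts_zero_one : V.Counts 0 1 := by
  refine ⟨one_pos, fun i => ?_⟩
  have : {w : List PUnit.{u + 1} | ThresholdEq 0 1 w.length i} = ⊤ :=
    Set.eq_univ_of_forall fun w => Or.inr ⟨Nat.zero_le _, Nat.zero_le _, Nat.modEq_one⟩
  rw [this]
  exact BooleanSubalgebra.top_mem

theorem Counts.max_lcm {t m t' m' : ℕ} (h : V.Counts t m) (h' : V.Counts t' m') :
    V.Counts (max t t') (m.lcm m') := by
  refine ⟨Nat.lcm_pos h.1 h'.1, fun i => ?_⟩
  have : {w : List PUnit.{u + 1} | ThresholdEq (max t t') (m.lcm m') w.length i} =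
      {w | ThresholdEq t m w.length i} ⊓ {w | ThresholdEq t' m' w.length i} := by
    ext w
    exact ThresholdEq.max_lcm_iff
  rw [this]
  exact BooleanSubalgebra.inf_mem (h.2 i) (h'.2 i)

theorem quotient_mem {A : Type u} [Finite A] {K : Set (List A)} (hK : K ∈ V.lang A)
    (x y : List A) : {w : List A | x ++ w ++ y ∈ K} ∈ V.lang A := by
  have left : ∀ (x : List A) (K : Set (List A)), K ∈ V.lang A →
      {w : List A | x ++ w ∈ K} ∈ V.lang A := by
    intro x
    induction x with
    | nil => exact fun K hK => by simpa using hK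
    | cons a x ih => exact fun K hK => ih _ (V.leftQuotient_mem a K hK)
  have right : ∀ (y : List A) (K : Set (List A)), K ∈ V.lang A →
      {w : List A | w ++ y ∈ K} ∈ V.lang A := by
    intro y
    induction y using List.reverseRecOn with
    | nil => exact fun K hK => by simpa using hK
    | append_singleton y a ih =>
      intro K hK
      have := ih _ (V.rightQuotient_mem a K hK)
      simpa [List.append_assoc] using this
  exact left x _ (right y K hK)

/-- A variety that counts up to `(t, m)` contains the languages that count, up to `(t, m)`, the
letters satisfying a predicate. -/
theorem Counts.countP_mem {t m : ℕ} (h : V.Counts t m) {B : Type u} [Finite B] (p : B → Bool)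
    (i : ℕ) : {w : List B | ThresholdEq t m (w.countP p) i} ∈ V.lang B := by
  let φ : FreeMonoid B →* FreeMonoid PUnit.{u + 1} :=
    FreeMonoid.lift fun b => if p b then FreeMonoid.of PUnit.unit else 1
  have hφ : ∀ w : List B,
      (FreeMonoid.toList (φ (FreeMonoid.ofList w))).length = w.countP p := by
    intro w
    induction w with
    | nil => simp
    | cons b w ih =>
      rw [FreeMonoid.ofList_cons, map_mul, FreeMonoid.toList_mul, List.length_append, ih,
        List.countP_cons]
      by_cases hb : p b <;> simp [φ, hb, add_comm]
  have := V.preimage_mem φ _ (h.2 i)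
  simpa only [Set.mem_ofPred_eq, hφ] using this

variable {A : Type u} [Finite A]

/-- Repetitions of one letter are distinguished by a commutative regular language of the variety
only through counting. -/
theorem exists_counts_replicate (hreg : V.IsRegular) (hcomm : V.IsCommutative)
    {K : Set (List A)} (hK : K ∈ V.lang A) (a : A) :
    ∃ t m, V.Counts t m ∧ ∀ i j, ThresholdEq t m i j → ∀ z : List A,
      (List.replicate i a ++ z ∈ K ↔ List.replicate j a ++ z ∈ K) := by
  have hfin : (Set.range (Language.leftQuotient (α := A) K)).Finite :=
    Language.IsRegular.finite_range_leftQuotient (hreg A hK)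
  let r : ℕ → ℕ → Prop := fun i j => ∀ z : List A,
    (List.replicate i a ++ z ∈ K ↔ List.replicate j a ++ z ∈ K)
  have hr : Equivalence r := ⟨fun i z => Iff.rfl, fun h z => (h z).symm,
    fun h h' z => (h z).trans (h' z)⟩
  have hadd : ∀ i j k, r i j → r (i + k) (j + k) := by
    intro i j k h z
    have := h (List.replicate k a ++ z)
    simpa only [← List.append_assoc, List.replicate_append_replicate] using this
  -- A regular language has finitely many left quotients, so two powers of `a` share one.
  have hne : ∃ i j, i < j ∧ r i j := by
    have hmaps : ∀ i : ℕ, Language.leftQuotient (α := A) K (List.replicate i a) ∈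
        Set.range (Language.leftQuotient (α := A) K) := fun i => ⟨_, rfl⟩
    obtain ⟨i, j, hij, he⟩ := Set.Finite.exists_lt_map_eq_of_forall_mem hmaps hfin
    exact ⟨i, j, hij, fun z => Set.ext_iff.1 he z⟩
  obtain ⟨t, m, hm, ht⟩ := exists_thresholdEq r hr hadd hne
  refine ⟨t, m, ⟨hm, fun i => ?_⟩, fun i j h => (ht i j).2 h⟩
  let φ : FreeMonoid PUnit.{u + 1} →* FreeMonoid A := FreeMonoid.lift fun _ => FreeMonoid.of a
  have hφ : ∀ w : List PUnit.{u + 1},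
      FreeMonoid.toList (φ (FreeMonoid.ofList w)) = List.replicate w.length a := by
    intro w
    induction w with
    | nil => simp
    | cons b w ih =>
      rw [FreeMonoid.ofList_cons, map_mul, FreeMonoid.toList_mul, ih]
      simp [φ, List.replicate_succ]
  -- These finitely many inverse images of quotients of `K` separate the classes of `r`, so each
  -- class lies in the variety.
  let F : Set (Set (List PUnit.{u + 1})) :=
    (fun Q : Language A => {w | List.replicate w.length a ∈ (Q : Set (List A))}) ''
      Set.range (Language.leftQuotient (α := A) K)
  refine mem_of_saturated _ (hfin.image _ : F.Finite) ?_ _ ?_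
  · rintro _ ⟨_, ⟨x, rfl⟩, rfl⟩
    have := V.preimage_mem φ _ (quotient_mem hK x [])
    simp only [List.append_nil, hφ] at this
    exact this
  · intro x y hxy hx
    refine ((ht _ _).1 fun z => ?_).trans hx
    have := hxy _ ⟨_, ⟨z, rfl⟩, rfl⟩
    -- The quotients in `F` put `z` before the power of `a`, whereas `r` puts it after;
    -- commutativity reconciles the two.
    have hc := fun n => hcomm A K hK _ _
      (List.perm_append_comm (l₁ := List.replicate n a) (l₂ := z))
    exact ((hc _).trans this.symm).trans (hc _).symm

theorem exists_counts_of_forall {ι : Type*} [Finite ι] {t m : ι → ℕ}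
    (h : ∀ i, V.Counts (t i) (m i)) :
    ∃ t' m', V.Counts t' m' ∧ ∀ i, t i ≤ t' ∧ m i ∣ m' := by
  have : ∀ s : Set ι, s.Finite → ∃ t' m', V.Counts t' m' ∧ ∀ i ∈ s, t i ≤ t' ∧ m i ∣ m' := by
    intro s hs
    induction s, hs using Set.Finite.induction_on with
    | empty => exact ⟨0, 1, counts_zero_one, by simp⟩
    | @insert i s _ _ ih =>
      obtain ⟨t', m', h', hs⟩ := ih
      refine ⟨_, _, (h i).max_lcm h', ?_⟩
      rintro j (rfl | hj)
      · exact ⟨le_max_left _ _, Nat.dvd_lcm_left _ _⟩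
      · exact ⟨(hs j hj).1.trans (le_max_right _ _), (hs j hj).2.trans (Nat.dvd_lcm_right _ _)⟩
  obtain ⟨t', m', h', hs⟩ := this Set.univ Set.finite_univ
  exact ⟨t', m', h', fun i => hs i (Set.mem_univ i)⟩

open Classical in
/-- Membership in a commutative regular language of the variety depends only on the numbers of
occurrences of the letters up to a threshold and a period that the variety can count. -/
theorem exists_counts_saturated (hreg : V.IsRegular) (hcomm : V.IsCommutative)
    {K : Set (List A)} (hK : K ∈ V.lang A) :
    ∃ t m, V.Counts t m ∧ ∀ x y : List A,
      (∀ a, ThresholdEq t m (x.count a) (y.count a)) → (x ∈ K ↔ y ∈ K) := by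
  choose t m hc hK' using exists_counts_replicate hreg hcomm hK
  obtain ⟨t', m', h', hle⟩ := exists_counts_of_forall hc
  refine ⟨t', m', h', fun x y hxy => ?_⟩
  -- Here `s` holds the letters whose counts may still differ; the induction corrects one letter at
  -- a time.
  have main : ∀ s : Set A, s.Finite → ∀ x : List A,
      (∀ a, ThresholdEq t' m' (x.count a) (y.count a)) →
      (∀ a ∉ s, x.count a = y.count a) → (x ∈ K ↔ y ∈ K) := by
    intro s hs
    induction s, hs using Set.Finite.induction_on with
    | empty =>
      intro x _ h
      exact hcomm A K hK x y (List.perm_iff_count.2 fun a => h a (Set.notMem_empty a))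
    | @insert a s _ _ ih =>
      intro x hx h
      let z := x.filter (fun b => b ≠ a)
      have hz : ∀ i b, (List.replicate i a ++ z).count b = if b = a then i else x.count b := by
        intro i b
        by_cases hb : b = a
        · subst hb
          simp [z, List.count_eq_zero_of_not_mem]
        · rw [List.count_append, List.count_filter (by simpa using hb)]
          simp [hb, List.count_replicate, Ne.symm hb]
      have hxz : x.Perm (List.replicate (x.count a) a ++ z) := by
        refine List.perm_iff_count.2 fun b => ?_
        rw [hz]
        split_ifs with hb
        · rw [hb]
        · rfl
      refine (hcomm A K hK _ _ hxz).trans ((hK' a _ _ ((hx a).mono (hle a).1 (hle a).2) z).trans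
        (ih _ (fun b => ?_) fun b hb => ?_))
      · rw [hz]
        split_ifs with hb
        · rw [hb]; exact ThresholdEq.refl _ _ _
        · exact hx b
      · rw [hz]
        split_ifs with hba
        · rw [hba]
        · exact h b (by simp [hba, hb])
  exact main Set.univ Set.finite_univ x hxy (by simp)

/-- If 0 and 1 were equivalent, all counts would be, and `K` would contain every word or none. -/
theorem exists_counts_not_zero_one (hreg : V.IsRegular) (hcomm : V.IsCommutative)
    (hnon : V.IsNontrivial) : ∃ t m, V.Counts t m ∧ ¬ ThresholdEq t m 0 1 := by
  classical
  obtain ⟨B, _, K, hK, hK₀, hK₁⟩ := hnon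
  obtain ⟨t, m, h, hs⟩ := exists_counts_saturated hreg hcomm hK
  refine ⟨t, m, h, fun h01 => ?_⟩
  have h0 : ∀ n, ThresholdEq t m n 0 := by
    intro n
    induction n with
    | zero => exact ThresholdEq.refl _ _ _
    | succ n ih =>
      have := (h01.symm.add_right n)
      rw [add_comm 1, zero_add] at this
      exact this.trans ih
  obtain ⟨x, hx⟩ := Set.nonempty_iff_ne_empty.2 hK₀
  exact hK₁ (Set.eq_univ_of_forall fun y => (hs x y fun a => (h0 _).trans (h0 _).symm).1 hx)

end LanguageVariety

end BlockProduct

/-! ### The exchange argument -/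

namespace BlockProduct

section Exchange

open Classical in
/-- Counting the letter `c` on `S` in two words that agree outside `S` amounts, up to a common
summand, to counting it on the positions where they differ. -/
theorem card_filter_add_card_filter {ι A : Type*} [Fintype ι] (S : Finset ι) (w w' : ι → A)
    (h : ∀ i ∉ S, w i = w' i) (c : A) :
    (S.filter fun i => w i = c).card + (Finset.univ.filter fun i => w i ≠ w' i ∧ w' i = c).card =
      (S.filter fun i => w' i = c).card +
        (Finset.univ.filter fun i => w i ≠ w' i ∧ w i = c).card := by
  have split : ∀ v : ι → A, (S.filter fun i => v i = c).card =
      (S.filter fun i => w i = w' i ∧ v i = c).card +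
        (Finset.univ.filter fun i => w i ≠ w' i ∧ v i = c).card := by
    intro v
    rw [← Finset.card_union_of_disjoint]
    · congr 1
      ext i
      simp only [Finset.mem_filter, Finset.mem_union, Finset.mem_univ, true_and]
      by_cases hi : i ∈ S
      · by_cases e : w i = w' i <;> simp [hi, e]
      · simp [hi, h i hi]
    · rw [Finset.disjoint_left]
      intro i hi hi'
      simp only [Finset.mem_filter] at hi hi'
      exact hi'.2.1 hi.2.1
  have e : (S.filter fun i => w i = w' i ∧ w i = c) = S.filter fun i => w i = w' i ∧ w' i = c := by
    ext i
    simp only [Finset.mem_filter]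
    constructor
    · rintro ⟨h₁, h₂, h₃⟩
      exact ⟨h₁, h₂, h₂ ▸ h₃⟩
    · rintro ⟨h₁, h₂, h₃⟩
      exact ⟨h₁, h₂, h₂ ▸ h₃⟩
  rw [split w, split w', e]
  omega

open Classical in
/-- Exchanging `t + m` letters `a` with `t` letters `b` on `S` moves `m` occurrences from `a`
to `b`. -/
theorem exists_exchange {ι A : Type*} [Fintype ι] (S : Finset ι) (t m : ℕ) (w : ι → A) {a b : A}
    (hab : a ≠ b) (ha : t + m ≤ (S.filter fun i => w i = a).card)
    (hb : t ≤ (S.filter fun i => w i = b).card) :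
    ∃ w' : ι → A, (∀ i ∉ S, w i = w' i) ∧
      (∀ c, ThresholdEq t m (Finset.univ.filter fun i => w i ≠ w' i ∧ w i = c).card
        (Finset.univ.filter fun i => w i ≠ w' i ∧ w' i = c).card) ∧
      (S.filter fun i => w' i = a).card + m = (S.filter fun i => w i = a).card ∧
      (S.filter fun i => w' i = b).card = (S.filter fun i => w i = b).card + m ∧
      ∀ c, c ≠ a → c ≠ b → (S.filter fun i => w' i = c).card = (S.filter fun i => w i = c).card := by
  -- Replacing just `m` letters `a` would compare the counts `m` and `0`, which are inequivalent
  -- when `t > 0`. The extra `t` letters moved in each direction lift both counts to the threshold.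
  obtain ⟨Ta, hTa, hTac⟩ := Finset.exists_subset_card_eq ha
  obtain ⟨Tb, hTb, hTbc⟩ := Finset.exists_subset_card_eq hb
  have hTa' : ∀ i ∈ Ta, i ∈ S ∧ w i = a := fun i hi => by simpa using hTa hi
  have hTb' : ∀ i ∈ Tb, i ∈ S ∧ w i = b := fun i hi => by simpa using hTb hi
  have hba : b ≠ a := hab.symm
  let w' : ι → A := fun i => if i ∈ Ta then b else if i ∈ Tb then a else w i
  have hw'a : ∀ i ∈ Ta, w' i = b := fun i hi => if_pos hi
  have hw'b : ∀ i ∈ Tb, w' i = a := fun i hi => by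
    have : i ∉ Ta := fun h => hab ((hTa' i h).2.symm.trans (hTb' i hi).2)
    simp [w', this, hi]
  have hw' : ∀ i, i ∉ Ta → i ∉ Tb → w' i = w i := fun i h₁ h₂ => by simp [w', h₁, h₂]
  have hS : ∀ i ∉ S, w i = w' i := fun i hi =>
    (hw' i (fun h => hi (hTa' i h).1) fun h => hi (hTb' i h).1).symm
  have d₁ : (Finset.univ.filter fun i => w i ≠ w' i ∧ w i = a) = Ta := by
    ext i
    simp only [Finset.mem_filter, Finset.mem_univ, true_and]
    by_cases h₁ : i ∈ Ta
    · simp [h₁, hw'a i h₁, (hTa' i h₁).2, hab]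
    · by_cases h₂ : i ∈ Tb
      · simp [h₁, (hTb' i h₂).2, hba]
      · simp [h₁, hw' i h₁ h₂]
  have d₂ : (Finset.univ.filter fun i => w i ≠ w' i ∧ w' i = a) = Tb := by
    ext i
    simp only [Finset.mem_filter, Finset.mem_univ, true_and]
    by_cases h₂ : i ∈ Tb
    · simp [h₂, hw'b i h₂, (hTb' i h₂).2, hba]
    · by_cases h₁ : i ∈ Ta
      · simp [h₂, hw'a i h₁, hba]
      · simp [h₂, hw' i h₁ h₂]
  have d₃ : (Finset.univ.filter fun i => w i ≠ w' i ∧ w i = b) = Tb := by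
    ext i
    simp only [Finset.mem_filter, Finset.mem_univ, true_and]
    by_cases h₂ : i ∈ Tb
    · simp [h₂, hw'b i h₂, (hTb' i h₂).2, hba]
    · by_cases h₁ : i ∈ Ta
      · simp [h₂, (hTa' i h₁).2, hab]
      · simp [h₂, hw' i h₁ h₂]
  have d₄ : (Finset.univ.filter fun i => w i ≠ w' i ∧ w' i = b) = Ta := by
    ext i
    simp only [Finset.mem_filter, Finset.mem_univ, true_and]
    by_cases h₁ : i ∈ Ta
    · simp [h₁, hw'a i h₁, (hTa' i h₁).2, hab]
    · by_cases h₂ : i ∈ Tb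
      · simp [h₁, hw'b i h₂, hab]
      · simp [h₁, hw' i h₁ h₂]
  have d₅ : ∀ c, c ≠ a → c ≠ b →
      (Finset.univ.filter fun i => w i ≠ w' i ∧ w i = c) = ∅ ∧
      (Finset.univ.filter fun i => w i ≠ w' i ∧ w' i = c) = ∅ := by
    intro c hca hcb
    constructor <;>
    · refine Finset.filter_eq_empty_iff.2 fun i _ => ?_
      by_cases h₁ : i ∈ Ta
      · simp [hw'a i h₁, (hTa' i h₁).2, hca.symm, hcb.symm]
      · by_cases h₂ : i ∈ Tb
        · simp [hw'b i h₂, (hTb' i h₂).2, hca.symm, hcb.symm]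
        · simp [hw' i h₁ h₂]
  have htm : ThresholdEq t m (t + m) t := Or.inr ⟨by omega, le_rfl, by simp [Nat.ModEq]⟩
  refine ⟨w', hS, fun c => ?_, ?_, ?_, fun c hca hcb => ?_⟩
  · by_cases hca : c = a
    · rw [hca, d₁, d₂, hTac, hTbc]
      exact htm
    · by_cases hcb : c = b
      · rw [hcb, d₃, d₄, hTac, hTbc]
        exact htm.symm
      · rw [(d₅ c hca hcb).1, (d₅ c hca hcb).2]
        exact ThresholdEq.refl _ _ _
  · have := card_filter_add_card_filter S w w' hS a
    rw [d₁, d₂, hTac, hTbc] at this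
    omega
  · have := card_filter_add_card_filter S w w' hS b
    rw [d₃, d₄, hTac, hTbc] at this
    omega
  · have := card_filter_add_card_filter S w w' hS c
    rw [(d₅ c hca hcb).1, (d₅ c hca hcb).2] at this
    omega

open Classical in
/-- A property of words that is preserved by modifications on `S` whose replaced and replacing
letters have equivalent counts is preserved by all modifications on `S` that keep the counts
on `S` equivalent. -/
theorem imp_of_card_thresholdEq {ι A : Type*} [Fintype ι] [Finite A] (S : Finset ι) {t m : ℕ}
    (hm : 0 < m) (Φ : (ι → A) → Prop)
    (hΦ : ∀ w w' : ι → A, (∀ i ∉ S, w i = w' i) →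
      (∀ a, ThresholdEq t m (Finset.univ.filter fun i => w i ≠ w' i ∧ w i = a).card
        (Finset.univ.filter fun i => w i ≠ w' i ∧ w' i = a).card) → Φ w → Φ w')
    (w w' : ι → A) (hS : ∀ i ∉ S, w i = w' i)
    (hcard : ∀ a, ThresholdEq t m (S.filter fun i => w i = a).card
      (S.filter fun i => w' i = a).card) (hw : Φ w) : Φ w' := by
  cases nonempty_fintype A
  have total : ∀ v : ι → A, ∑ a, (S.filter fun i => v i = a).card = S.card := fun v =>
    (Finset.card_eq_sum_card_fiberwise (fun i _ => Finset.mem_univ (v i))).symm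
  -- The measure is the total excess of `w` over `w'`; truncated subtraction makes letters in
  -- deficit contribute 0.
  induction hN : ∑ a, ((S.filter fun i => w i = a).card - (S.filter fun i => w' i = a).card)
    using Nat.strong_induction_on generalizing w with
  | _ N ih =>
    by_cases heq : ∀ a, (S.filter fun i => w i = a).card = (S.filter fun i => w' i = a).card
    · refine hΦ w w' hS (fun a => Or.inl ?_) hw
      have := card_filter_add_card_filter S w w' hS a
      rw [heq a] at this
      omega
    · have hlt : ∀ v v' : ι → A,
          (∃ c, (S.filter fun i => v i = c).card ≠ (S.filter fun i => v' i = c).card) →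
          ∃ a, (S.filter fun i => v' i = a).card < (S.filter fun i => v i = a).card := by
        rintro v v' ⟨c, hc⟩
        by_contra! hle
        refine hc ?_
        have := (Finset.sum_eq_sum_iff_of_le (s := Finset.univ) fun a _ => hle a).1
          ((total v).trans (total v').symm)
        exact this c (Finset.mem_univ c)
      obtain ⟨c, hc⟩ := not_forall.1 heq
      obtain ⟨a, ha⟩ := hlt w w' ⟨c, hc⟩
      obtain ⟨b, hb⟩ := hlt w' w ⟨c, fun h => hc h.symm⟩
      have hab : a ≠ b := by
        rintro rfl
        omega
      -- Unequal but equivalent counts differ by at least `m`, the smaller being at least `t`: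
      -- exactly the supply that an exchange needs, and it cannot overshoot.
      have gap : ∀ i j, ThresholdEq t m i j → i < j → t ≤ i ∧ i + m ≤ j := by
        rintro i j (h | ⟨h₁, h₂, h₃⟩) hij
        · omega
        · refine ⟨h₁, ?_⟩
          have := Nat.le_of_dvd (by omega) ((Nat.modEq_iff_dvd' hij.le).1 h₃)
          omega
      obtain ⟨ha₁, ha₂⟩ := gap _ _ (hcard a).symm ha
      obtain ⟨hb₁, hb₂⟩ := gap _ _ (hcard b) hb
      obtain ⟨w₁, h₁, h₂, h₃, h₄, h₅⟩ := exists_exchange S t m w hab (by omega) hb₁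
      have hle : ∀ c, c ≠ a → (S.filter fun i => w₁ i = c).card -
          (S.filter fun i => w' i = c).card ≤
          (S.filter fun i => w i = c).card - (S.filter fun i => w' i = c).card := by
        intro c hca
        by_cases hcb : c = b
        · subst hcb
          omega
        · rw [h₅ c hca hcb]
      refine ih _ ?_ w₁ (fun i hi => (h₁ i hi).symm.trans (hS i hi)) (fun c => ?_)
        (hΦ w w₁ h₁ h₂ hw) rfl
      · rw [← hN]
        refine Finset.sum_lt_sum (fun c _ => ?_) ⟨a, Finset.mem_univ a, by omega⟩
        by_cases hca : c = a
        · subst hca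
          omega
        · exact hle c hca
      · by_cases hca : c = a
        · subst hca
          refine ThresholdEq.trans (Or.inr ⟨by omega, by omega, ?_⟩) (hcard c)
          rw [← h₃]
          simp [Nat.ModEq]
        · by_cases hcb : c = b
          · subst hcb
            refine ThresholdEq.trans (Or.inr ⟨by omega, by omega, ?_⟩) (hcard c)
            rw [h₄]
            simp [Nat.ModEq]
          · rw [h₅ c hca hcb]
            exact hcard c

end Exchange

end BlockProduct

/-! ### Letter counts and lengths in the block product -/

namespace BlockProduct

/-- The pair of distances of a position of a word to the two ends of the word. -/
def position {n : ℕ} (i : Fin n) : ℕ × ℕ := (i, n - 1 - i)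

open Classical in
/-- The number of occurrences of the letter `a` at positions in `P`. -/
noncomputable def letterCount {A : Type*} (P : Set (ℕ × ℕ)) (a : A) {n : ℕ} (w : Fin n → A) : ℕ :=
  ((Finset.univ.filter fun i => position i ∈ P).filter fun i => w i = a).card

theorem transduction_eq_ofFn {A : Type u} (D : Setoid (ℕ × ℕ)) (l : List A) :
    transduction D l =
      List.ofFn fun i : Fin l.length => (l.get i, Quotient.mk D (position i)) := by
  apply List.ext_getElem
  · simp [transduction]
  · intro i h₁ h₂
    simp [transduction, position]

theorem countP_ofFn {B : Type*} (p : B → Bool) {n : ℕ} (f : Fin n → B) :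
    (List.ofFn f).countP p = (Finset.univ.filter fun i => p (f i)).card := by
  induction n with
  | zero => simp
  | succ n ih =>
    rw [List.ofFn_succ, List.countP_cons, ih, Fin.card_filter_univ_succ, add_comm]
    split_ifs <;> simp [add_comm]

theorem letterCount_congr {A : Type*} {P : Set (ℕ × ℕ)} {n : ℕ} {w w' : Fin n → A}
    (h : ∀ i, position i ∈ P → w i = w' i) (a : A) : letterCount P a w = letterCount P a w' := by
  unfold letterCount
  congr 1
  ext i
  simp only [Finset.mem_filter, Finset.mem_univ, true_and]
  exact and_congr_right fun hi => by rw [h i hi]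

theorem letterCount_inter_add_diff {A : Type*} (P R : Set (ℕ × ℕ)) (a : A) {n : ℕ}
    (w : Fin n → A) :
    letterCount (R ∩ P) a w + letterCount (R \ P) a w = letterCount R a w := by
  classical
  unfold letterCount
  rw [← Finset.card_union_of_disjoint]
  · congr 1
    ext i
    simp only [Finset.mem_filter, Finset.mem_univ, true_and, Finset.mem_union, Set.mem_inter_iff,
      Set.mem_sdiff]
    tauto
  · rw [Finset.disjoint_left]
    intro i hi hi'
    simp only [Finset.mem_filter, Finset.mem_univ, true_and] at hi hi'
    exact hi'.1.2 hi.1.2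

theorem finite_quotient_ker_mem (P : Set (ℕ × ℕ)) :
    Finite (Quotient (Setoid.ker fun q => q ∈ P)) :=
  Finite.of_injective _ (Setoid.kerLift_injective fun q => q ∈ P)

variable {V : LanguageVariety.{u}} {A : Type u}

/-- Counting, up to a threshold and a period, the positions in `P` with letters in `s`. -/
theorem card_mem_blockProduct [Finite A] {t m : ℕ} (h : V.Counts t m) (P : Set (ℕ × ℕ)) (s : Set A)
    (j : ℕ) (c : List A → ℕ)
    (hc : ∀ l : List A, c l = {i : Fin l.length | position i ∈ P ∧ l.get i ∈ s}.ncard) :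
    {l : List A | ThresholdEq t m (c l) j} ∈ blockProduct V A := by
  classical
  let D : Setoid (ℕ × ℕ) := Setoid.ker fun q => q ∈ P
  have hD : Finite (Quotient D) := finite_quotient_ker_mem P
  let p : A × Quotient D → Bool := fun x =>
    decide (x.1 ∈ s ∧ Quotient.lift (s := D) (fun q => q ∈ P) (fun _ _ h => h) x.2)
  refine BooleanSubalgebra.subset_closure ⟨D, hD, _, h.countP_mem p j, ?_⟩
  ext l
  have : (transduction D l).countP p = c l := by
    rw [transduction_eq_ofFn, countP_ofFn, hc, Set.ncard_eq_toFinset_card']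
    congr 1
    ext i
    simp only [p, Finset.mem_filter, Finset.mem_univ, true_and, decide_eq_true_eq,
      Set.mem_toFinset, Set.mem_ofPred_eq]
    exact and_comm
  simp only [Set.mem_preimage, Set.mem_ofPred_eq, this]

theorem letterCount_mem_blockProduct [Finite A] {t m : ℕ} (h : V.Counts t m) (P : Set (ℕ × ℕ)) (a : A)
    (j : ℕ) : {l : List A | ThresholdEq t m (letterCount P a l.get) j} ∈ blockProduct V A := by
  classical
  refine card_mem_blockProduct h P {a} j _ fun l => ?_
  rw [Set.ncard_eq_toFinset_card']
  unfold letterCount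
  congr 1
  ext i
  simp

/-- For a nontrivial variety, the block product contains every language defined by the length
of words. -/
theorem length_mem_blockProduct [Finite A] {t m : ℕ} (h : V.Counts t m) (h01 : ¬ ThresholdEq t m 0 1)
    (N : Set ℕ) : {l : List A | l.length ∈ N} ∈ blockProduct V A := by
  have pos : ∀ N : Set ℕ, {l : List A | 0 < l.length ∧ l.length ∈ N} ∈ blockProduct V A := by
    intro N
    -- A nonempty word has one position with first coordinate 0, where `q.2 + 1` is the length. The
    -- count is thus 1 or 0.
    have := card_mem_blockProduct (A := A) h {q | q.1 = 0 ∧ q.2 + 1 ∈ N} Set.univ 1 _ fun l => rfl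
    convert this using 1
    ext l
    simp only [Set.mem_ofPred_eq, Set.mem_univ, and_true]
    by_cases hl : 0 < l.length ∧ l.length ∈ N
    · have : {i : Fin l.length | (position i).1 = 0 ∧ (position i).2 + 1 ∈ N} =
          {⟨0, hl.1⟩} := by
        ext i
        simp only [Set.mem_ofPred_eq, Set.mem_singleton_iff, position, Fin.ext_iff]
        constructor
        · exact fun hi => hi.1
        · intro hi
          refine ⟨hi, ?_⟩
          rw [hi, Nat.sub_zero, Nat.sub_add_cancel hl.1]
          exact hl.2
      rw [this, Set.ncard_singleton]
      exact iff_of_true hl (ThresholdEq.refl _ _ _)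
    · have : {i : Fin l.length | (position i).1 = 0 ∧ (position i).2 + 1 ∈ N} = ∅ := by
        ext i
        simp only [Set.mem_ofPred_eq, Set.mem_empty_iff_false, iff_false, position]
        rintro ⟨h₁, h₂⟩
        have hi := i.2
        refine hl ⟨by omega, ?_⟩
        rwa [h₁, Nat.sub_zero, Nat.sub_add_cancel (by omega)] at h₂
      rw [this, Set.ncard_empty]
      exact iff_of_false hl h01
  -- The empty word has no positions, so the second set is needed to isolate it.
  refine mem_of_saturated _ (F := {{l : List A | 0 < l.length ∧ l.length ∈ N},
    {l : List A | 0 < l.length ∧ l.length ∈ Set.univ}}) (by simp) ?_ _ ?_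
  · rintro S (rfl | rfl)
    · exact pos N
    · exact pos Set.univ
  · intro x y hxy hx
    have h₁ := hxy _ (Or.inl rfl)
    have h₂ := hxy _ (Or.inr rfl)
    simp only [Set.mem_ofPred_eq, Set.mem_univ, and_true] at h₁ h₂ hx ⊢
    by_cases h₀ : 0 < x.length
    · exact (h₁.1 ⟨h₀, hx⟩).2
    · have : ¬ 0 < y.length := fun h => h₀ (h₂.2 h)
      have e : x.length = y.length := by omega
      rwa [← e]

/-- A language determined by the length of words and finitely many members of the block product
belongs to the block product. -/
theorem mem_blockProduct_of_saturated [Finite A] {t m : ℕ} (h : V.Counts t m) (h01 : ¬ ThresholdEq t m 0 1)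
    {F : Set (Set (List A))} (hF : F.Finite) (hF𝓑 : ∀ S ∈ F, S ∈ blockProduct V A)
    (L : Set (List A))
    (hL : ∀ x y : List A, x.length = y.length → (∀ S ∈ F, (x ∈ S ↔ y ∈ S)) → x ∈ L → y ∈ L) :
    L ∈ blockProduct V A := by
  -- `len G` collects the words whose length occurs in `L` with membership pattern `G`. There are
  -- finitely many patterns, and each `len G` is a length condition.
  let len : Set (Set (List A)) → Set (List A) := fun G =>
    {l | l.length ∈ {k | ∃ x ∈ L, x.length = k ∧ {S ∈ F | x ∈ S} = G}}
  refine mem_of_saturated _ (hF.union (hF.finite_subsets.image len)) ?_ _ ?_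
  · rintro S (hS | ⟨G, _, rfl⟩)
    · exact hF𝓑 S hS
    · exact length_mem_blockProduct h h01 _
  · intro x y hxy hx
    have h₁ : ∀ S ∈ F, (x ∈ S ↔ y ∈ S) := fun S hS => hxy S (Or.inl hS)
    obtain ⟨z, hz, hzy, hzG⟩ := (hxy (len {S ∈ F | x ∈ S})
      (Or.inr ⟨_, Set.sep_subset _ _, rfl⟩)).1 ⟨x, hx, rfl, rfl⟩
    refine hL z y hzy (fun S hS => ?_) hz
    have := Set.ext_iff.1 hzG S
    simp only [Set.mem_sep_iff, hS, true_and] at this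
    exact this.trans (h₁ S hS)

/-! ### The ideal of position sets on which counts determine `L` -/

/-- Membership in `L` of words that agree outside `P` is determined by finitely many letter counts
on subsets of `P`. -/
def CountDetermined (V : LanguageVariety.{u}) (L : Set (List A)) (P : Set (ℕ × ℕ)) : Prop :=
  ∃ 𝓡 : Set (Set (ℕ × ℕ)), 𝓡.Finite ∧ (∀ R ∈ 𝓡, R ⊆ P) ∧ ∃ t m, V.Counts t m ∧
    ∀ (n : ℕ) (w w' : Fin n → A), (∀ i, position i ∉ P → w i = w' i) →
      (∀ R ∈ 𝓡, ∀ a, ThresholdEq t m (letterCount R a w) (letterCount R a w')) →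
      List.ofFn w ∈ L → List.ofFn w' ∈ L

namespace CountDetermined

variable {L : Set (List A)} {P P' : Set (ℕ × ℕ)}

theorem empty : CountDetermined V L ∅ := by
  refine ⟨∅, Set.finite_empty, by simp, 0, 1, LanguageVariety.counts_zero_one, ?_⟩
  intro n w w' h _ hw
  rwa [← show w = w' from funext fun i => h i (Set.notMem_empty _)]

/-- Outside `P'` the words agree, so the counts on `R \ P'` are a common summand and only `R ∩ P'`
matters. -/
theorem mono (h : CountDetermined V L P) (hP : P' ⊆ P) : CountDetermined V L P' := by
  obtain ⟨𝓡, hfin, hsub, t, m, hc, hL⟩ := h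
  refine ⟨(fun R => R ∩ P') '' 𝓡, hfin.image _, ?_, t, m, hc, fun n w w' hw hcount => ?_⟩
  · rintro _ ⟨R, _, rfl⟩
    exact Set.inter_subset_right
  · refine hL n w w' (fun i hi => hw i fun h => hi (hP h)) fun R hR a => ?_
    rw [← letterCount_inter_add_diff P' R a w, ← letterCount_inter_add_diff P' R a w',
      letterCount_congr (P := R \ P') (fun i hi => hw i hi.2) a]
    exact (hcount _ ⟨R, hR, rfl⟩ a).add_right _

theorem union_of_disjoint (h : CountDetermined V L P) (h' : CountDetermined V L P')
    (hd : Disjoint P P') : CountDetermined V L (P ∪ P') := by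
  classical
  obtain ⟨𝓡, hfin, hsub, t, m, hc, hL⟩ := h
  obtain ⟨𝓡', hfin', hsub', t', m', hc', hL'⟩ := h'
  refine ⟨𝓡 ∪ 𝓡', hfin.union hfin', ?_, _, _, hc.max_lcm hc', fun n w w' hw hcount hwL => ?_⟩
  · rintro R (hR | hR)
    · exact (hsub R hR).trans Set.subset_union_left
    · exact (hsub' R hR).trans Set.subset_union_right
  -- The word `v` interpolates: it changes `w` on `P` first, leaving `P'` for the second hypothesis.
  · let v : Fin n → A := fun i => if position i ∈ P then w' i else w i
    have hvP : ∀ i, position i ∈ P → v i = w' i := fun i hi => if_pos hi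
    have hvP' : ∀ i, position i ∉ P → v i = w i := fun i hi => if_neg hi
    have hdis : ∀ q ∈ P', q ∉ P := fun q hq hq' => Set.disjoint_left.1 hd hq' hq
    refine hL' n v w' (fun i hi => ?_) (fun R hR a => ?_)
      (hL n w v (fun i hi => (hvP' i hi).symm) (fun R hR a => ?_) hwL)
    · by_cases hP : position i ∈ P
      · exact hvP i hP
      · rw [hvP' i hP]
        exact hw i fun h => h.elim hP hi
    · rw [letterCount_congr (w := v) (w' := w)
        (fun i hi => hvP' i (hdis _ (hsub' R hR hi))) a]
      exact (ThresholdEq.max_lcm_iff.1 (hcount R (Or.inr hR) a)).2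
    · rw [letterCount_congr (w := v) (w' := w') (fun i hi => hvP i (hsub R hR hi)) a]
      exact (ThresholdEq.max_lcm_iff.1 (hcount R (Or.inl hR) a)).1

theorem union (h : CountDetermined V L P) (h' : CountDetermined V L P') :
    CountDetermined V L (P ∪ P') := by
  rw [← Set.union_sdiff_self]
  exact h.union_of_disjoint (h'.mono Set.sdiff_subset) Set.disjoint_sdiff_right

theorem mem_blockProduct [Finite A] (h : CountDetermined V L Set.univ) {t₀ m₀ : ℕ} (h₀ : V.Counts t₀ m₀)
    (h01 : ¬ ThresholdEq t₀ m₀ 0 1) : L ∈ blockProduct V A := by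
  obtain ⟨𝓡, hfin, -, t, m, hc, hL⟩ := h
  let T : Set (ℕ × ℕ) × A × ℕ → Set (List A) := fun x =>
    {l | ThresholdEq t m (letterCount x.1 x.2.1 l.get) x.2.2}
  refine mem_blockProduct_of_saturated h₀ h01
    ((hfin.prod (Set.finite_univ.prod (Set.finite_lt_nat (t + m)))).image T) ?_ L ?_
  · rintro _ ⟨x, _, rfl⟩
    exact letterCount_mem_blockProduct hc _ _ _
  · intro x y hxy hF hx
    obtain ⟨n, w, rfl⟩ : ∃ n, ∃ w : Fin n → A, List.ofFn w = x :=
      ⟨x.length, x.get, List.ofFn_get x⟩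
    obtain ⟨w', rfl⟩ : ∃ w' : Fin n → A, List.ofFn w' = y := by
      have hn : y.length = n := by simpa using hxy.symm
      subst hn
      exact ⟨y.get, List.ofFn_get y⟩
    have hcnt : ∀ (R : Set (ℕ × ℕ)) (a : A) (v : Fin n → A),
        letterCount R a (List.ofFn v).get = letterCount R a v := by
      have : ∀ (l : List A) (k : ℕ) (hk : l.length = k) (R : Set (ℕ × ℕ)) (a : A) (v : Fin k → A),
          l = List.ofFn v → letterCount R a l.get = letterCount R a v := by
        intro l k hk R a v hlv
        subst hk
        congr 1
        exact List.ofFn_injective ((List.ofFn_get l).trans hlv)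
      exact fun R a v => this _ n (by simp) R a v rfl
    refine hL n w w' (fun i hi => absurd (Set.mem_univ _) hi) (fun R hR a => ?_) hx
    obtain ⟨j, hj, hji⟩ := ThresholdEq.exists_lt (t := t) hc.1 (letterCount R a w)
    have := (hF _ ⟨(R, a, j), ⟨hR, Set.mem_univ a, hj⟩, rfl⟩).1
      (by simpa only [T, Set.mem_ofPred_eq, hcnt] using hji.symm)
    simp only [T, Set.mem_ofPred_eq, hcnt] at this
    exact hji.symm.trans this.symm

/-- If `L` is not determined by letter counts, this is witnessed locally at an ultrafilter. -/
theorem exists_ultrafilter (h : ¬ CountDetermined V L Set.univ) :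
    ∃ α : Ultrafilter (ℕ × ℕ), ∀ P ∈ α, ¬ CountDetermined V L P := by
  -- The filter dual to the ideal, proper by hypothesis; any ultrafilter refining it avoids the
  -- ideal.
  let F : Filter (ℕ × ℕ) :=
    { sets := {P | CountDetermined V L Pᶜ}
      univ_sets := by simpa using empty
      sets_of_superset := fun hx hxy => mono hx (Set.compl_subset_compl.2 hxy)
      inter_sets := fun hx hy => by
        simpa [Set.compl_inter] using union hx hy }
  have hF : F.NeBot := by
    refine ⟨fun hbot => h ?_⟩
    have : (∅ : Set (ℕ × ℕ)) ∈ F := by rw [hbot]; exact Filter.mem_bot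
    have : CountDetermined V L (∅ : Set (ℕ × ℕ))ᶜ := this
    simpa using this
  refine ⟨Ultrafilter.of F, fun P hP hdet => ?_⟩
  have hPc : Pᶜ ∈ F := by
    change CountDetermined V L Pᶜᶜ
    simpa using hdet
  exact Ultrafilter.compl_notMem_iff.2 hP (Ultrafilter.of_le F hPc)

end CountDetermined

end BlockProduct

/-! ### Substitutions under a transduction -/

namespace BlockProduct

section Substitution

variable {A : Type u}

theorem length_foldl_set (l : List ((ℕ × ℕ) × A)) (w : List A) :
    (l.foldl (fun w qa => w.set qa.1.1 qa.2) w).length = w.length := by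
  induction l generalizing w with
  | nil => rfl
  | cons x l ih => rw [List.foldl_cons, ih, List.length_set]

theorem getElem?_foldl_set_of_notMem (l : List ((ℕ × ℕ) × A)) (w : List A) (j : ℕ)
    (hj : ∀ x ∈ l, x.1.1 ≠ j) :
    (l.foldl (fun w qa => w.set qa.1.1 qa.2) w)[j]? = w[j]? := by
  induction l generalizing w with
  | nil => rfl
  | cons x l ih =>
    rw [List.foldl_cons, ih _ fun y hy => hj y (List.mem_cons_of_mem _ hy),
      List.getElem?_set_ne (hj x List.mem_cons_self)]

theorem getElem?_foldl_set_of_mem (l : List ((ℕ × ℕ) × A)) (w : List A)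
    (hl : l.Pairwise fun x y => x.1.1 ≠ y.1.1) (x : (ℕ × ℕ) × A) (hx : x ∈ l)
    (hxw : x.1.1 < w.length) :
    (l.foldl (fun w qa => w.set qa.1.1 qa.2) w)[x.1.1]? = some x.2 := by
  induction l generalizing w with
  | nil => exact absurd hx List.not_mem_nil
  | cons y l ih =>
    rw [List.pairwise_cons] at hl
    rw [List.foldl_cons]
    rcases List.mem_cons.1 hx with rfl | hx
    · rw [getElem?_foldl_set_of_notMem _ _ _ fun y hy => (hl.1 y hy).symm,
        List.getElem?_set_self hxw]
    · exact ih _ hl.2 hx (by rwa [List.length_set])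

variable {t : Triple A}

theorem length_substitute (t : Triple A) : (substitute t).length = t.1.length := by
  unfold substitute
  split_ifs
  · exact length_foldl_set _ _
  · rfl

theorem getElem?_substitute (ht : t ∈ correctSubstitutions A) (i : ℕ) (hi : i < t.2.2.length) :
    (substitute t)[t.2.2[i].1]? = some (t.2.1[i]'(ht.1 ▸ hi)) := by
  obtain ⟨h₁, h₂, h₃, h₄⟩ := ht
  rw [substitute, if_pos ⟨h₁, h₂, h₃, h₄⟩]
  have hpw : (t.2.2.zip t.2.1).Pairwise fun x y => x.1.1 ≠ y.1.1 := by
    have : ((t.2.2.zip t.2.1).map Prod.fst).Pairwise fun q q' => q.1 < q'.1 := by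
      rw [List.map_fst_zip h₁.ge]
      exact h₄
    exact (List.pairwise_map.1 this).imp fun h => h.ne
  have hmem : (t.2.2[i], t.2.1[i]'(h₁ ▸ hi)) ∈ t.2.2.zip t.2.1 := by
    have hlen : i < (t.2.2.zip t.2.1).length := by
      rw [List.length_zip]
      omega
    have := List.getElem_mem hlen
    rwa [List.getElem_zip] at this
  exact getElem?_foldl_set_of_mem _ _ hpw _ hmem (h₃ _ (List.getElem_mem hi))

theorem getElem?_substitute_of_notMem (ht : t ∈ correctSubstitutions A) (j : ℕ)
    (hj : j ∉ t.2.2.map Prod.fst) : (substitute t)[j]? = t.1[j]? := by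
  rw [substitute, if_pos ht]
  refine getElem?_foldl_set_of_notMem _ _ _ fun x hx hxj => hj ?_
  exact List.mem_map.2 ⟨x.1, (List.of_mem_zip hx).1, hxj⟩

theorem filterMap_eq_of_map_eq {X Y : Type*} {g : X → Option Y} {xs : List X} {l : List Y}
    (h : xs.map g = l.map some) : xs.filterMap g = l := by
  have : (xs.map g).filterMap id = (l.map some).filterMap id := by rw [h]
  simpa [List.filterMap_map] using this

/-- The labelled letter at position `i` of the word `w`. -/
def labelledLetter (D : Setoid (ℕ × ℕ)) (w : List A) (i : ℕ) : Option (A × Quotient D) :=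
  w[i]?.map fun a => (a, Quotient.mk D (i, w.length - 1 - i))

open Classical in
/-- The labelled letters of `w` at the positions that do not occur in `p`. -/
noncomputable def unchangedLetters (D : Setoid (ℕ × ℕ)) (w : List A) (p : List (ℕ × ℕ)) :
    List (A × Quotient D) :=
  ((List.range w.length).filter fun i => i ∉ p.map Prod.fst).filterMap (labelledLetter D w)

theorem transduction_eq_filterMap (D : Setoid (ℕ × ℕ)) (w : List A) :
    (List.range w.length).filterMap (labelledLetter D w) = transduction D w := by
  refine filterMap_eq_of_map_eq (List.ext_getElem (by simp [transduction]) fun i h₁ h₂ => ?_)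
  have hi : i < w.length := by simpa using h₁
  simp [transduction, labelledLetter, hi]

/-- If all substituted positions lie in the class `c`, the substituted word has, up to a
permutation, the unchanged labelled letters and the substituted letters labelled by `c`. -/
theorem transduction_substitute_perm (D : Setoid (ℕ × ℕ)) (ht : t ∈ correctSubstitutions A)
    (c : Quotient D) (hc : ∀ q ∈ t.2.2, Quotient.mk D q = c) :
    (transduction D (substitute t)).Perm
      (unchangedLetters D t.1 t.2.2 ++ t.2.1.map fun a => (a, c)) := by
  classical
  have hnodup : (t.2.2.map Prod.fst).Nodup :=
    List.pairwise_map.2 (ht.2.2.2.imp fun h => h.ne)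
  have hperm : (List.range t.1.length).Perm
      ((List.range t.1.length).filter (fun i => i ∉ t.2.2.map Prod.fst) ++
        t.2.2.map Prod.fst) := by
    rw [List.perm_ext_iff_of_nodup List.nodup_range]
    · intro i
      simp only [List.mem_append, List.mem_filter, List.mem_range, decide_eq_true_eq]
      constructor
      · intro hi
        by_cases h : i ∈ t.2.2.map Prod.fst
        · exact Or.inr h
        · exact Or.inl ⟨hi, h⟩
      · rintro (h | h)
        · exact h.1
        · obtain ⟨q, hq, rfl⟩ := List.mem_map.1 h
          exact ht.2.2.1 q hq
    · refine List.Nodup.append (List.nodup_range.filter _) hnodup ?_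
      intro i hi hi'
      have := (List.mem_filter.1 hi).2
      rw [decide_eq_true_eq] at this
      exact this hi'
  rw [← transduction_eq_filterMap, length_substitute]
  refine (hperm.filterMap _).trans (List.Perm.of_eq ?_)
  rw [List.filterMap_append]
  congr 1
  · refine List.filterMap_congr fun i hi => ?_
    have := (List.mem_filter.1 hi).2
    rw [decide_eq_true_eq] at this
    rw [labelledLetter, labelledLetter, getElem?_substitute_of_notMem ht i this, length_substitute]
  · refine filterMap_eq_of_map_eq (List.ext_getElem (by simp [ht.1]) fun i h₁ h₂ => ?_)
    have hi : i < t.2.2.length := by simpa using h₁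
    have hmem := List.getElem_mem hi
    -- The second coordinate of a substituted position is forced by the word length, so its label is
    -- the class of the given pair.
    have e : (t.2.2[i].1, t.1.length - 1 - t.2.2[i].1) = t.2.2[i] := by
      refine Prod.ext rfl ?_
      have := ht.2.1 _ hmem
      change t.1.length - 1 - t.2.2[i].1 = t.2.2[i].2
      omega
    simp only [List.getElem_map, labelledLetter, getElem?_substitute ht i hi, length_substitute, e,
      hc _ hmem, Option.map_some]

end Substitution

/-! ### Soundness of the equations -/

section Soundness

variable {V : LanguageVariety.{u}} {A : Type u} [Finite A]

theorem StonePoint.mem_iff {X : Type u} {𝓑 : BooleanSubalgebra (Set X)} (p : StonePoint 𝓑)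
    (μ : Ultrafilter X) (h : ∀ L ∈ p.sets, L ∈ μ) {L : Set X} (hL : L ∈ 𝓑) :
    L ∈ p.sets ↔ L ∈ μ := by
  refine ⟨h L, fun hμ => (p.mem_or_compl_mem L hL).resolve_right fun hc => ?_⟩
  exact Ultrafilter.compl_notMem_iff.2 hμ (h _ hc)

/-- Two ultrafilters with the same image under `g` agree on conditions on the value of `g`. -/
theorem mem_iff_of_map_eq {X Y : Type*} {μ ν : Ultrafilter X} {g : X → Y}
    (h : μ.map g = ν.map g) (S : Set Y) : g ⁻¹' S ∈ μ ↔ g ⁻¹' S ∈ ν := by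
  rw [← Ultrafilter.mem_map, ← Ultrafilter.mem_map, h]

theorem mem_ultrafilter_congr {X : Type*} {μ : Ultrafilter X} {S T E : Set X}
    (hE : E ∈ μ) (h : ∀ x ∈ E, (x ∈ S ↔ x ∈ T)) : S ∈ μ ↔ T ∈ μ := by
  constructor
  · exact fun hS => Filter.mem_of_superset (Filter.inter_mem hE hS) fun x hx => (h x hx.1).1 hx.2
  · exact fun hT => Filter.mem_of_superset (Filter.inter_mem hE hT) fun x hx => (h x hx.1).2 hx.2

/-- The equations hold for the generators of the block product. -/
theorem preimage_transduction_mem_iff (hreg : V.IsRegular) (hcomm : V.IsCommutative)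
    {p q : ProfiniteWord A} (hpq : SatisfiesIdentity (V.lang A) p q)
    {γu γv : Ultrafilter (Triple A)} (hγ : Compatible p q γu γv)
    (D : Setoid (ℕ × ℕ)) [Finite (Quotient D)] {K : Set (List (A × Quotient D))}
    (hK : K ∈ V.lang (A × Quotient D)) :
    transduction D ⁻¹' K ∈ γu.map substitute ↔ transduction D ⁻¹' K ∈ γv.map substitute := by
  rw [Ultrafilter.mem_map, Ultrafilter.mem_map]
  -- Correctness of a substitution can be read off from `lengthMap`, hence holds almost surely for
  -- both ultrafilters or for neither.
  let C : Set (List A × ℕ × List (ℕ × ℕ)) := {x | x.2.1 = x.2.2.length ∧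
    (∀ q ∈ x.2.2, q.1 + q.2 + 1 = x.1.length) ∧ (∀ q ∈ x.2.2, q.1 < x.1.length) ∧
    x.2.2.Pairwise (fun q q' => q.1 < q'.1)}
  have hCiff : correctSubstitutions A ∈ γu ↔ correctSubstitutions A ∈ γv :=
    mem_iff_of_map_eq hγ.length_eq C
  by_cases hC : correctSubstitutions A ∈ γu
  swap
  · have hCu := Ultrafilter.compl_mem_iff_notMem.2 hC
    have hCv := Ultrafilter.compl_mem_iff_notMem.2 (mt hCiff.2 hC)
    have e : ∀ t ∈ (correctSubstitutions A)ᶜ, (t ∈ substitute ⁻¹' (transduction D ⁻¹' K) ↔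
        t ∈ (lengthMap (A := A)) ⁻¹' {x | transduction D x.1 ∈ K}) := by
      intro t ht
      simp only [Set.mem_preimage, Set.mem_ofPred_eq, substitute, if_neg ht, lengthMap]
    rw [mem_ultrafilter_congr hCu e, mem_ultrafilter_congr hCv e]
    exact mem_iff_of_map_eq hγ.length_eq _
  · obtain ⟨α, hα⟩ := hγ.content_ultra
    obtain ⟨c, hc⟩ : ∃ c : Quotient D, Quotient.mk D ⁻¹' {c} ∈ α := by
      obtain ⟨c, hc⟩ := Ultrafilter.eq_pure_of_finite (α.map (Quotient.mk D))
      refine ⟨c, ?_⟩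
      rw [← Ultrafilter.mem_map, hc]
      exact rfl
    have hcu : {t : Triple A | ∀ q ∈ t.2.2, Quotient.mk D q = c} ∈ γu := by
      have : Quotient.mk D ⁻¹' {c} ∈ betaContent γu := by rw [hα]; exact hc
      exact this
    have hcv : {t : Triple A | ∀ q ∈ t.2.2, Quotient.mk D q = c} ∈ γv := by
      have : Quotient.mk D ⁻¹' {c} ∈ betaContent γv := by rw [← hγ.content_eq, hα]; exact hc
      exact this
    let Q : Triple A → Language (A × Quotient D) := fun t =>
      Language.leftQuotient (α := A × Quotient D) K (unchangedLetters D t.1 t.2.2)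
    have hfin : (Set.range (Language.leftQuotient (α := A × Quotient D) K)).Finite :=
      Language.IsRegular.finite_range_leftQuotient (hreg _ hK)
    -- The quotient of `K` by the unchanged letters takes finitely many values, so it is almost
    -- surely constant; it depends only on `lengthMap`, so the same `x` serves `γv`.
    obtain ⟨_, ⟨x, rfl⟩, hx⟩ : ∃ R ∈ Set.range (Language.leftQuotient (α := A × Quotient D) K),
        Q ⁻¹' {R} ∈ γu := by
      refine (Ultrafilter.finite_biUnion_mem_iff hfin).1 ?_
      refine Filter.univ_mem' fun t => ?_
      exact Set.mem_biUnion (x := Q t) ⟨_, rfl⟩ rfl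
    have hx' : Q ⁻¹' {Language.leftQuotient (α := A × Quotient D) K x} ∈ γv :=
      (mem_iff_of_map_eq hγ.length_eq
        {y | Language.leftQuotient (α := A × Quotient D) K (unchangedLetters D y.1 y.2.2) =
          Language.leftQuotient (α := A × Quotient D) K x}).1 hx
    let R : Set (List A) := {s | x ++ s.map (fun a => (a, c)) ∈ K}
    have hR : R ∈ V.lang A := by
      let φ : FreeMonoid A →* FreeMonoid (A × Quotient D) := FreeMonoid.map fun a => (a, c)
      have := V.preimage_mem φ _ (LanguageVariety.quotient_mem hK x [])
      simp only [List.append_nil] at this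
      exact this
    have e : ∀ t ∈ correctSubstitutions A ∩ ({t | ∀ q ∈ t.2.2, Quotient.mk D q = c} ∩
        Q ⁻¹' {Language.leftQuotient (α := A × Quotient D) K x}),
        (t ∈ substitute ⁻¹' (transduction D ⁻¹' K) ↔ t ∈ secondComponent ⁻¹' R) := by
      rintro t ⟨h₁, h₂, h₃⟩
      refine (hcomm _ K hK _ _ (transduction_substitute_perm D h₁ c h₂)).trans ?_
      exact Set.ext_iff.1 h₃ (t.2.1.map fun a => (a, c))
    rw [mem_ultrafilter_congr
        (Filter.inter_mem hC (Filter.inter_mem hcu hx)) e,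
      mem_ultrafilter_congr
        (Filter.inter_mem (hCiff.1 hC) (Filter.inter_mem hcv hx')) e,
      ← Ultrafilter.mem_map, ← Ultrafilter.mem_map,
      ← p.mem_iff _ hγ.left_subset (hreg A hR), ← q.mem_iff _ hγ.right_subset (hreg A hR)]
    simpa using hpq R hR [] []

/-- Ultrafilter membership respects Boolean operations, so the generators suffice. -/
theorem mem_iff_of_mem_blockProduct (hreg : V.IsRegular) (hcomm : V.IsCommutative)
    {L : Set (List A)} (hL : L ∈ blockProduct V A)
    {e : Ultrafilter (List A) × Ultrafilter (List A)} (he : e ∈ blockEquations V A) :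
    L ∈ e.1 ↔ L ∈ e.2 := by
  obtain ⟨p, q, hpq, γu, γv, hγ, rfl⟩ := he
  induction hL using BooleanSubalgebra.closure_bot_sup_induction with
  | mem L hL =>
    obtain ⟨D, hD, K, hK, rfl⟩ := hL
    exact preimage_transduction_mem_iff hreg hcomm hpq hγ D hK
  | bot => exact iff_of_false Ultrafilter.empty_notMem Ultrafilter.empty_notMem
  | sup L _ L' _ h h' =>
    exact Ultrafilter.union_mem_iff.trans ((or_congr h h').trans Ultrafilter.union_mem_iff.symm)
  | compl L _ h =>
    exact Ultrafilter.compl_mem_iff_notMem.trans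
      ((not_congr h).trans Ultrafilter.compl_mem_iff_notMem.symm)

end Soundness

end BlockProduct

/-! ### Completeness of the equations -/

namespace BlockProduct

section Completeness

variable {A : Type u}

/-- A pair of words of the same length. -/
abbrev WordPair (A : Type u) := Σ n : ℕ, (Fin n → A) × (Fin n → A)

namespace WordPair

open Classical in
/-- The positions where the two words differ. -/
noncomputable def differences (x : WordPair A) : List (Fin x.1) :=
  (List.finRange x.1).filter fun i => x.2.1 i ≠ x.2.2 i

theorem mem_differences (x : WordPair A) (i : Fin x.1) :
    i ∈ x.differences ↔ x.2.1 i ≠ x.2.2 i := by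
  simp [differences]

/-- The substitution in the first word, at the positions where the two words differ, of the
letters of `v`. -/
noncomputable def toTriple (x : WordPair A) (v : Fin x.1 → A) : Triple A :=
  (List.ofFn x.2.1, x.differences.map v, x.differences.map position)

theorem toTriple_mem (x : WordPair A) (v : Fin x.1 → A) :
    x.toTriple v ∈ correctSubstitutions A := by
  refine ⟨by simp [toTriple], fun q hq => ?_, fun q hq => ?_, ?_⟩
  · obtain ⟨i, _, rfl⟩ := List.mem_map.1 hq
    have := i.2
    simp only [toTriple, position, List.length_ofFn]
    omega
  · obtain ⟨i, _, rfl⟩ := List.mem_map.1 hq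
    simp [toTriple, position]
  · refine List.pairwise_map.2 ?_
    exact (List.pairwise_lt_finRange x.1).filter _

theorem substitute_toTriple (x : WordPair A) (v : Fin x.1 → A)
    (hv : ∀ i, x.2.1 i = x.2.2 i → v i = x.2.1 i) :
    substitute (x.toTriple v) = List.ofFn v := by
  refine List.ext_getElem? fun j => ?_
  by_cases hj : j ∈ (x.toTriple v).2.2.map Prod.fst
  · obtain ⟨q, hq, rfl⟩ := List.mem_map.1 hj
    obtain ⟨k, hk, rfl⟩ := List.getElem_of_mem hq
    rw [getElem?_substitute (x.toTriple_mem v) k hk]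
    simp [toTriple, position]
  · rw [getElem?_substitute_of_notMem (x.toTriple_mem v) j hj]
    simp only [toTriple, List.getElem?_ofFn]
    split_ifs with h
    · rw [hv]
      by_contra hne
      refine hj (List.mem_map.2 ⟨position ⟨j, h⟩, List.mem_map.2 ⟨⟨j, h⟩, ?_, rfl⟩, rfl⟩)
      exact (x.mem_differences _).2 hne
    · rfl

theorem forall_mem_toTriple_iff (x : WordPair A) (v : Fin x.1 → A) (P : Set (ℕ × ℕ)) :
    (∀ q ∈ (x.toTriple v).2.2, q ∈ P) ↔ ∀ i, x.2.1 i ≠ x.2.2 i → position i ∈ P := by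
  simp only [toTriple, List.mem_map, forall_exists_index, and_imp, forall_apply_eq_imp_iff₂,
    mem_differences]

-- This translates counts in the substituted word into the cardinalities of the exchange argument.
open Classical in
theorem count_toTriple (x : WordPair A) (v : Fin x.1 → A) (a : A) :
    (x.toTriple v).2.1.count a =
      (Finset.univ.filter fun i => x.2.1 i ≠ x.2.2 i ∧ v i = a).card := by
  have h := countP_ofFn (fun i : Fin x.1 => decide (x.2.1 i ≠ x.2.2 i ∧ v i = a)) id
  simp only [id, decide_eq_true_eq] at h
  rw [← h, List.ofFn_id, toTriple, differences, List.count, List.countP_map, List.countP_filter]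
  refine List.countP_congr fun i _ => ?_
  simp [and_comm]

end WordPair

open Classical in
/-- The pairs of a word in `L` and a word outside `L` that differ only at positions in `P` and
whose letters at these positions have equivalent counts. -/
def badPairs (L : Set (List A)) (P : Set (ℕ × ℕ)) (t m : ℕ) : Set (WordPair A) :=
  {x | List.ofFn x.2.1 ∈ L ∧ List.ofFn x.2.2 ∉ L ∧
    (∀ i, x.2.1 i ≠ x.2.2 i → position i ∈ P) ∧
    ∀ a, ThresholdEq t m ((x.toTriple x.2.1).2.1.count a) ((x.toTriple x.2.2).2.1.count a)}

theorem badPairs_mono {L : Set (List A)} {P P' : Set (ℕ × ℕ)} {t m t' m' : ℕ} (hP : P' ⊆ P)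
    (ht : t ≤ t') (hm : m ∣ m') : badPairs L P' t' m' ⊆ badPairs L P t m :=
  fun _ hx => ⟨hx.1, hx.2.1, fun i hi => hP (hx.2.2.1 i hi), fun a => (hx.2.2.2 a).mono ht hm⟩

/-- The profinite word that an ultrafilter of languages induces. -/
def regularTrace (μ : Ultrafilter (List A)) : ProfiniteWord A where
  sets := {L | L ∈ regularLanguages A ∧ L ∈ μ}
  sets_subset := fun _ h => h.1
  nonempty := ⟨⊤, BooleanSubalgebra.top_mem, Filter.univ_mem⟩
  empty_notMem := fun h => Ultrafilter.empty_notMem h.2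
  mem_of_superset := fun _ h _ hK hLK => ⟨hK, Filter.mem_of_superset h.2 hLK⟩
  inter_mem := fun _ h _ h' =>
    ⟨BooleanSubalgebra.inf_mem h.1 h'.1, Filter.inter_mem h.2 h'.2⟩
  mem_or_compl_mem := fun L hL => (μ.mem_or_compl_mem L).imp (fun h => ⟨hL, h⟩)
    fun h => ⟨BooleanSubalgebra.compl_mem hL, h⟩

variable {V : LanguageVariety.{u}} [Finite A]

/-- Counting on `P` alone suffices: without bad pairs, no modification of the kind allowed in
`imp_of_card_thresholdEq` leaves `L`. -/
theorem countDetermined_of_badPairs_eq_empty {L : Set (List A)} {P : Set (ℕ × ℕ)} {t m : ℕ}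
    (hc : V.Counts t m) (h : badPairs L P t m = ∅) : CountDetermined V L P := by
  classical
  refine ⟨{P}, Set.finite_singleton P, by simp, t, m, hc, fun n w w' hw hcount hwL => ?_⟩
  refine imp_of_card_thresholdEq (Finset.univ.filter fun i => position i ∈ P) hc.1
    (fun v => List.ofFn v ∈ L) ?_ w w' (fun i hi => hw i (by simpa using hi))
    (hcount P rfl) hwL
  intro v v' hv hvc hvL
  by_contra hv'L
  have : (⟨n, v, v'⟩ : WordPair A) ∈ badPairs L P t m := by
    refine ⟨hvL, hv'L, fun i hi => ?_, fun a => ?_⟩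
    · by_contra hiP
      exact hi (hv i (by simpa using hiP))
    · rw [WordPair.count_toTriple, WordPair.count_toTriple]
      exact hvc a
  rw [h] at this
  exact this

/-- Bad pairs for `P ∩ P'` and a common refinement of two countings are bad for both, so these
nonempty sets form a filter base. -/
theorem exists_ultrafilter_badPairs {L : Set (List A)} (α : Ultrafilter (ℕ × ℕ))
    (hα : ∀ P ∈ α, ¬ CountDetermined V L P) :
    ∃ Γ : Ultrafilter (WordPair A), ∀ P ∈ α, ∀ t m, V.Counts t m → badPairs L P t m ∈ Γ := by
  let F : Filter (WordPair A) :=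
    { sets := {S | ∃ P ∈ α, ∃ t m, V.Counts t m ∧ badPairs L P t m ⊆ S}
      univ_sets := ⟨Set.univ, Filter.univ_mem, 0, 1, LanguageVariety.counts_zero_one,
        Set.subset_univ _⟩
      sets_of_superset := fun ⟨P, hP, t, m, hc, h⟩ hST => ⟨P, hP, t, m, hc, h.trans hST⟩
      inter_sets := fun ⟨P, hP, t, m, hc, h⟩ ⟨P', hP', t', m', hc', h'⟩ =>
        ⟨P ∩ P', Filter.inter_mem hP hP', _, _, hc.max_lcm hc', Set.subset_inter
          ((badPairs_mono Set.inter_subset_left (le_max_left _ _) (Nat.dvd_lcm_left _ _)).trans h)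
          ((badPairs_mono Set.inter_subset_right (le_max_right _ _)
            (Nat.dvd_lcm_right _ _)).trans h')⟩ }
  have hF : F.NeBot := by
    refine ⟨fun hbot => ?_⟩
    have : (∅ : Set (WordPair A)) ∈ F := by rw [hbot]; exact Filter.mem_bot
    obtain ⟨P, hP, t, m, hc, h⟩ := this
    exact hα P hP (countDetermined_of_badPairs_eq_empty hc (Set.subset_empty_iff.1 h))
  exact ⟨Ultrafilter.of F, fun P hP t m hc =>
    Ultrafilter.of_le F ⟨P, hP, t, m, hc, subset_rfl⟩⟩

/-- A language that is not determined by letter counts violates one of the equations. -/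
theorem exists_blockEquation (hreg : V.IsRegular) (hcomm : V.IsCommutative) {L : Set (List A)}
    (hL : ¬ CountDetermined V L Set.univ) : ∃ e ∈ blockEquations V A, L ∈ e.1 ∧ L ∉ e.2 := by
  classical
  obtain ⟨α, hα⟩ := CountDetermined.exists_ultrafilter hL
  obtain ⟨Γ, hΓ⟩ := exists_ultrafilter_badPairs α hα
  let Tu : WordPair A → Triple A := fun x => x.toTriple x.2.1
  let Tv : WordPair A → Triple A := fun x => x.toTriple x.2.2
  have hTu : ∀ x, substitute (Tu x) = List.ofFn x.2.1 := fun x =>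
    x.substitute_toTriple x.2.1 fun i _ => rfl
  have hTv : ∀ x, substitute (Tv x) = List.ofFn x.2.2 := fun x =>
    x.substitute_toTriple x.2.2 fun i h => h.symm
  have hbase : badPairs L Set.univ 0 1 ∈ Γ :=
    hΓ Set.univ Filter.univ_mem 0 1 LanguageVariety.counts_zero_one
  have hcontent : ∀ T : WordPair A → Triple A,
      (∀ (x : WordPair A) (P : Set (ℕ × ℕ)), (∀ q ∈ (T x).2.2, q ∈ P) ↔
        ∀ i, x.2.1 i ≠ x.2.2 i → position i ∈ P) →
      betaContent (Γ.map T) = (α : Filter (ℕ × ℕ)) := by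
    intro T hT
    have hin : ∀ P ∈ α, {x : WordPair A | ∀ i, x.2.1 i ≠ x.2.2 i → position i ∈ P} ∈ Γ :=
      fun P hP => Filter.mem_of_superset (hΓ P hP 0 1 LanguageVariety.counts_zero_one)
        fun x hx => hx.2.2.1
    ext P
    rw [mem_betaContent, Ultrafilter.mem_map]
    have e : T ⁻¹' {t | ∀ q ∈ t.2.2, q ∈ P} =
        {x : WordPair A | ∀ i, x.2.1 i ≠ x.2.2 i → position i ∈ P} := by
      ext x
      exact hT x P
    rw [e]
    refine ⟨fun hP => ?_, hin P⟩
    -- Otherwise differences would lie almost surely both in `P` and in its complement; the two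
    -- words would coincide, yet only one is in `L`.
    by_contra hPα
    have hPc := hin _ (Ultrafilter.compl_mem_iff_notMem.2 hPα)
    obtain ⟨x, ⟨hx₁, hx₂⟩, hx⟩ :=
      Ultrafilter.nonempty_of_mem (Filter.inter_mem (Filter.inter_mem hP hPc) hbase)
    refine hx.2.1 ?_
    rw [← show x.2.1 = x.2.2 from funext fun i => by_contra fun hi => hx₂ i hi (hx₁ i hi)]
    exact hx.1
  have hcu := hcontent Tu fun x P => x.forall_mem_toTriple_iff x.2.1 P
  have hcv := hcontent Tv fun x P => x.forall_mem_toTriple_iff x.2.2 P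
  refine ⟨((Γ.map Tu).map substitute, (Γ.map Tv).map substitute),
    ⟨regularTrace ((Γ.map Tu).map secondComponent), regularTrace ((Γ.map Tv).map secondComponent),
      ?_, Γ.map Tu, Γ.map Tv, ?_, rfl⟩, ?_, ?_⟩
  · intro K hK x y
    -- Almost every pair has equivalent counts for the counting attached to `K`, and the context
    -- `x`, `y` adds the same amount on both sides.
    obtain ⟨t, m, hc, hs⟩ := LanguageVariety.exists_counts_saturated hreg hcomm hK
    refine and_congr Iff.rfl ?_
    simp only [Ultrafilter.mem_map]
    refine mem_ultrafilter_congr (hΓ Set.univ Filter.univ_mem t m hc) fun z hz => ?_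
    refine hs _ _ fun a => ?_
    have := ((hz.2.2.2 a).add_right (x.count a + y.count a))
    simp only [List.count_append]
    convert this using 1
    · change _ + (Tu z).2.1.count a + _ = (Tu z).2.1.count a + _
      omega
    · change _ + (Tv z).2.1.count a + _ = (Tv z).2.1.count a + _
      omega
  · refine ⟨?_, fun K hK => hK.2, fun K hK => hK.2, hcu.trans hcv.symm, α, hcu⟩
    rw [Ultrafilter.map_map, Ultrafilter.map_map]
    congr 1
    funext x
    simp [Tu, Tv, WordPair.toTriple, lengthMap]
  · simp only [Ultrafilter.mem_map]
    exact Filter.mem_of_superset hbase fun x hx => by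
      simpa only [Set.mem_preimage, hTu] using hx.1
  · simp only [Ultrafilter.mem_map]
    refine Ultrafilter.compl_mem_iff_notMem.1 (Filter.mem_of_superset hbase fun x hx => ?_)
    simpa only [Set.mem_preimage, Set.mem_compl_iff, hTv] using hx.2.1

end Completeness

end BlockProduct

theorem mainTheorem1 (V : BlockProduct.LanguageVariety.{u}) (hreg : V.IsRegular)
    (hcomm : V.IsCommutative) (hnontriv : V.IsNontrivial) (A : Type u) [Finite A] :
    BlockProduct.IsDefinedBy (BlockProduct.blockProduct V A)
      (BlockProduct.blockEquations V A) := by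
  intro L
  refine ⟨fun hL e he => BlockProduct.mem_iff_of_mem_blockProduct hreg hcomm hL he, fun h => ?_⟩
  -- Nontriviality enters through `h01`, which puts all length conditions into the block product.
  obtain ⟨t, m, hc, h01⟩ := BlockProduct.LanguageVariety.exists_counts_not_zero_one hreg hcomm
    hnontriv
  refine BlockProduct.CountDetermined.mem_blockProduct (by_contra fun hn => ?_) hc h01
  obtain ⟨e, he, h₁, h₂⟩ := BlockProduct.exists_blockEquation hreg hcomm hn
  exact h₂ ((h e he).1 h₁)
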